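/- Let $\mathbb{N}$ be the set of positive integers. An $r$-graph $G$ consists of a finite vertex set $V(G)$ and a set $E(G)$ of edges, each of which is an $r$-element subset of $V(G)$. Its Lagrangian is $$\lambda(G)=\max\Big\{\sum_{e\in E(G)}\ \prod_{i\in e}x_i \;:\; x_i\ge 0 \text{ for all } i\in V(G),\ \sum_{i\in V(G)}x_i=1\Big\}.$$ For distinct $r$-element sets $A,B\subset\mathbb{N}$, say that $A$ precedes $B$ in the colex ordering if $\max(A\mathbin{\triangle}B)\in B$. Let $C_{r,m}$ be the $r$-graph whose edges are the first $m$ sets in the colex ordering of the $r$-element subsets of $\mathbb{N}$ and whose vertices are the elements of these edges, and let $[s]^{(r)}$ be the $r$-graph on the vertex set $\{1,\dots,s\}$ whose edges are all $r$-element subsets of it. Let $m$ and $t$ be positive integers with $m=\binom{t}{3}-3$. Then the Frankl–Füredi conjecture is true for $r=3$ and this value of $m$: $C_{3,m}$ has $m$ edges, and every $3$-graph $G$ with exactly $m$ edges, on any finite number of vertices, satisfies $\lambda(G)\le\lambda(C_{3,m})$. In particular, if $m=\binom{s}{3}$ for some integer $s\ge 0$, then $[s]^{(3)}$ has the largest Lagrangian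 among all $3$-graphs with $m$ edges. -/

import Mathlib

universe u

/-- An `r`-uniform graph (`r`-graph): a finite vertex set `V(G)` together with a set of edges
`E(G) ⊆ V(G)^{(r)}`, each edge being an `r`-element subset of the vertex set.
Isolated vertices are allowed. -/
structure RGraph (α : Type*) (r : ℕ) where
  /-- the vertex set `V(G)` -/
  verts : Finset α
  /-- the edge set `E(G)` -/
  edges : Finset (Finset α)
  edges_subset : edges ⊆ verts.powersetCard r

namespace RGraph

variable {α : Type*} {r : ℕ}

/-- The polynomial `λ(G, x) = ∑_{e ∈ E(G)} ∏_{i ∈ e} x_i`. -/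
def weight (G : RGraph α r) (x : α → ℝ) : ℝ :=
  ∑ e ∈ G.edges, ∏ i ∈ e, x i

/-- `x` is a legal weighting for `G`: nonnegative weights on the vertices, of total weight `1`.
(Values of `x` outside the vertex set play no role.) -/
def IsLegal (G : RGraph α r) (x : α → ℝ) : Prop :=
  (∀ i ∈ G.verts, 0 ≤ x i) ∧ ∑ i ∈ G.verts, x i = 1

/-- The Lagrangian `λ(G) = max {λ(G, x) : x a legal weighting for G}`. The supremum is attained
whenever `G` has a vertex, see `RGraph.isGreatest_lagrangian`. -/
noncomputable def lagrangian (G : RGraph α r) : ℝ :=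
  sSup {y : ℝ | ∃ x : α → ℝ, G.IsLegal x ∧ y = G.weight x}

/-- The Lagrangian is a maximum. -/
theorem isGreatest_lagrangian (G : RGraph α r) (hG : G.verts.Nonempty) :
    IsGreatest {y : ℝ | ∃ x : α → ℝ, G.IsLegal x ∧ y = G.weight x} G.lagrangian := by
  classical
  let ext : (G.verts → ℝ) → α → ℝ := fun z a => if h : a ∈ G.verts then z ⟨a, h⟩ else 0
  have hext : Continuous fun z => G.weight (ext z) := by
    unfold weight
    refine continuous_finsetSum _ fun e _ => continuous_finsetProd _ fun i _ => ?_
    by_cases h : i ∈ G.verts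
    · simpa [ext, h] using continuous_apply _
    · simpa [ext, h] using continuous_const
  have hset : {y : ℝ | ∃ x : α → ℝ, G.IsLegal x ∧ y = G.weight x} =
      (fun z => G.weight (ext z)) '' stdSimplex ℝ G.verts := by
    ext y
    constructor
    · rintro ⟨x, ⟨h0, h1⟩, rfl⟩
      refine ⟨fun i => x i, ⟨fun i => h0 i i.2, ?_⟩, ?_⟩
      · rw [← h1]; exact Finset.sum_coe_sort G.verts x
      · refine Finset.sum_congr rfl fun e he => Finset.prod_congr rfl fun i hi => ?_
        have := (Finset.mem_powersetCard.1 (G.edges_subset he)).1 hi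
        simp [ext, this]
    · rintro ⟨z, ⟨h0, h1⟩, rfl⟩
      refine ⟨ext z, ⟨fun i hi => by simpa [ext, hi] using h0 ⟨i, hi⟩, ?_⟩, rfl⟩
      rw [← h1, ← Finset.sum_coe_sort G.verts]
      exact Finset.sum_congr rfl fun i _ => by simp [ext]
  have hne : (stdSimplex ℝ G.verts).Nonempty := by
    obtain ⟨v, hv⟩ := hG
    exact ⟨_, single_mem_stdSimplex ℝ (⟨v, hv⟩ : G.verts)⟩
  have hc := (isCompact_stdSimplex ℝ G.verts).image hext
  unfold lagrangian
  rw [hset]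
  exact hc.isGreatest_sSup (hne.image _)

/-- `[n]^{(r)}`: the complete `r`-graph on the vertex set `[n] = {1, …, n}`. -/
def complete (n r : ℕ) : RGraph ℕ r where
  verts := Finset.Icc 1 n
  edges := (Finset.Icc 1 n).powersetCard r
  edges_subset := subset_rfl

end RGraph

open Finset.Colex in
/-- The first `m` sets in the colex ordering of the `r`-element sets of positive integers
(`r ≥ 1`): the `r`-sets having fewer than `m` predecessors. All of them are contained in
`[r + m]`, so it suffices to look at subsets of `[r + m]`;
see `card_colexFirst` and `mem_colexFirst_of_lt`. -/
def colexFirst (r m : ℕ) : Finset (Finset ℕ) :=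
  {A ∈ (Finset.Icc 1 (r + m)).powersetCard r |
    ({B ∈ (Finset.Icc 1 (r + m)).powersetCard r | toColex B < toColex A}).card < m}

/-- `colexFirst r m` has exactly `m` members. -/
theorem card_colexFirst (r m : ℕ) (hr : 0 < r) : (colexFirst r m).card = m := by
  classical
  set P := (Finset.Icc 1 (r + m)).powersetCard r with hP
  let rk : Finset ℕ → ℕ := fun A => ({B ∈ P | toColex B < toColex A}).card
  have hlt : ∀ A ∈ P, ∀ B ∈ P, toColex A < toColex B → rk A < rk B := by
    intro A hA B hB h
    refine Finset.card_lt_card ⟨?_, ?_⟩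
    · intro C hC
      simp only [Finset.mem_filter] at hC ⊢
      exact ⟨hC.1, hC.2.trans h⟩
    · intro hs
      have : A ∈ ({C ∈ P | toColex C < toColex A} : Finset _) :=
        hs (by simp [hA, h])
      simp at this
  have hinj : Set.InjOn rk P := by
    intro A hA B hB h
    rcases lt_trichotomy (toColex A) (toColex B) with h' | h' | h'
    · exact absurd h (hlt A hA B hB h').ne
    · exact toColex.injective h'
    · exact absurd h (hlt B hB A hA h').ne'
  have himg : P.image rk = Finset.range P.card := by
    refine Finset.eq_of_subset_of_card_le ?_ ?_
    · intro k hk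
      obtain ⟨A, hA, rfl⟩ := Finset.mem_image.1 hk
      refine Finset.mem_range.2 (Finset.card_lt_card ⟨Finset.filter_subset _ _, fun hs => ?_⟩)
      have := hs hA
      simp at this
    · rw [Finset.card_image_of_injOn hinj, Finset.card_range]
  have hcard : m ≤ P.card := by
    rw [hP, Finset.card_powersetCard, Nat.card_Icc, Nat.add_sub_cancel]
    clear_value P
    clear himg hinj hlt rk hP
    induction m with
    | zero => simp
    | succ m ih =>
      obtain ⟨s, rfl⟩ : ∃ s, r = s + 1 := ⟨r - 1, by omega⟩
      have h1 : (s + 1 + (m + 1)).choose (s + 1) =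
          (s + 1 + m).choose s + (s + 1 + m).choose (s + 1) := by
        rw [← add_assoc, Nat.choose_succ_succ]
      have h2 : 0 < (s + 1 + m).choose s := Nat.choose_pos (by omega)
      have h3 := ih
      omega
  have heq : (colexFirst r m).image rk = Finset.range m := by
    ext k
    simp only [Finset.mem_image, Finset.mem_range]
    constructor
    · rintro ⟨A, hA, rfl⟩
      exact (Finset.mem_filter.1 hA).2
    · intro hk
      have : k ∈ P.image rk := himg ▸ Finset.mem_range.2 (hk.trans_le hcard)
      obtain ⟨A, hA, rfl⟩ := Finset.mem_image.1 this
      exact ⟨A, Finset.mem_filter.2 ⟨hA, hk⟩, rfl⟩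
  have hinj' : Set.InjOn rk (colexFirst r m) :=
    hinj.mono fun A hA => (Finset.mem_filter.1 hA).1
  rw [← Finset.card_image_of_injOn hinj', heq, Finset.card_range]

/-- `colexFirst r m` is an initial segment of the colex ordering of the `r`-element sets of
positive integers. -/
theorem mem_colexFirst_of_lt {r m : ℕ} {A B : Finset ℕ} (hA : A ∈ colexFirst r m)
    (hB : B.card = r) (hpos : ∀ b ∈ B, 0 < b) (hBA : toColex B < toColex A) :
    B ∈ colexFirst r m := by
  obtain ⟨hA1, hA2⟩ := Finset.mem_filter.1 hA
  have hAs := (Finset.mem_powersetCard.1 hA1).1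
  refine Finset.mem_filter.2 ⟨Finset.mem_powersetCard.2 ⟨fun b hb => ?_, hB⟩, ?_⟩
  · exact Finset.mem_Icc.2 ⟨hpos b hb, Finset.Colex.forall_le_mono hBA.le
      (fun a ha => (Finset.mem_Icc.1 (hAs ha)).2) b hb⟩
  · refine (Finset.card_le_card fun C hC => ?_).trans_lt hA2
    simp only [Finset.mem_filter] at hC ⊢
    exact ⟨hC.1, hC.2.trans hBA⟩

/-- `C_{r,m}`: the `r`-graph whose edges are the first `m` sets in the colex ordering of the
`r`-element sets of positive integers; its vertices are the elements of its edges. -/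
def colexGraph (r m : ℕ) : RGraph ℕ r where
  verts := (colexFirst r m).biUnion id
  edges := colexFirst r m
  edges_subset := fun _ hA => Finset.mem_powersetCard.2
    ⟨Finset.subset_biUnion_of_mem id hA,
      (Finset.mem_powersetCard.1 (Finset.mem_filter.1 hA).1).2⟩

/-- Among all `r`-graphs with `m` edges, on any finite number of vertices, the `r`-graph `G` with
`m` edges has the largest Lagrangian. (Vertices are taken from arbitrary types in universe `u`.) -/
def HasLargestLagrangian {r : ℕ} (G : RGraph ℕ r) (m : ℕ) : Prop :=
  G.edges.card = m ∧
    ∀ (V : Type u) (H : RGraph V r), H.edges.card = m → H.lagrangian ≤ G.lagrangian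

/-- The weight `∑_{e ∈ E} ∏_{i ∈ e} x_i` of a family of finite sets. -/
def edgeWeight {α : Type*} (E : Finset (Finset α)) (x : α → ℝ) : ℝ :=
  ∑ e ∈ E, ∏ i ∈ e, x i

theorem exists_antitone_enumeration {V : Type*} (S : Finset V) (hS : S.Nonempty) (x : V → ℝ) :
    ∃ g : ℕ → V, Set.BijOn g (Finset.Icc 1 S.card) S ∧
      AntitoneOn (fun i => x (g i)) (Finset.Icc 1 S.card) := by
  obtain ⟨v, hv⟩ := hS
  let f : Fin S.card → ℝ := fun i => - x (S.equivFin.symm i)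
  let σ := Tuple.sort f
  have hσ : Monotone (f ∘ σ) := Tuple.monotone_sort f
  let g : ℕ → V := fun i =>
    if h : i - 1 < S.card then (S.equivFin.symm (σ ⟨i - 1, h⟩) : V) else v
  have hlt : ∀ i ∈ Finset.Icc 1 S.card, i - 1 < S.card := by
    intro i hi
    have := Finset.mem_Icc.1 hi
    omega
  have hg : ∀ i (hi : i ∈ Finset.Icc 1 S.card),
      g i = (S.equivFin.symm (σ ⟨i - 1, hlt i hi⟩) : V) := fun i hi => dif_pos (hlt i hi)
  have hinj : Set.InjOn g (Finset.Icc 1 S.card) := by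
    intro i hi j hj h
    have hi' := Finset.mem_coe.1 hi
    have hj' := Finset.mem_coe.1 hj
    rw [hg i hi', hg j hj'] at h
    have h1 := σ.injective (S.equivFin.symm.injective (Subtype.ext h))
    have h2 := congrArg Fin.val h1
    have := Finset.mem_Icc.1 hi'
    have := Finset.mem_Icc.1 hj'
    simp only at h2
    omega
  refine ⟨g, ⟨fun i hi => ?_, hinj, fun w hw => ?_⟩, fun i hi j hj hij => ?_⟩
  · rw [hg i (Finset.mem_coe.1 hi)]
    exact Subtype.prop _
  · let k := σ.symm (S.equivFin ⟨w, hw⟩)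
    have hk : (k : ℕ) + 1 ∈ Finset.Icc 1 S.card := Finset.mem_Icc.2 ⟨by omega, k.2⟩
    refine ⟨k + 1, hk, ?_⟩
    rw [hg _ hk]
    have : (⟨(k : ℕ) + 1 - 1, hlt _ hk⟩ : Fin S.card) = k := Fin.ext (by simp)
    rw [this]
    simp [k]
  · have hi' := Finset.mem_coe.1 hi
    have hj' := Finset.mem_coe.1 hj
    have : f (σ ⟨i - 1, hlt i hi'⟩) ≤ f (σ ⟨j - 1, hlt j hj'⟩) :=
      hσ (show (⟨i - 1, _⟩ : Fin S.card) ≤ ⟨j - 1, _⟩ from Fin.mk_le_mk.2 (by omega))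
    simp only [f] at this
    simp only [hg i hi', hg j hj']
    linarith

theorem exists_relabel {V : Type*} {r : ℕ} (S : Finset V) (hS : S.Nonempty)
    (E : Finset (Finset V)) (hE : E ⊆ S.powersetCard r) (x : V → ℝ) :
    ∃ (E' : Finset (Finset ℕ)) (x' : ℕ → ℝ), E' ⊆ (Finset.Icc 1 S.card).powersetCard r ∧
      E'.card = E.card ∧ edgeWeight E' x' = edgeWeight E x ∧
      ∑ i ∈ Finset.Icc 1 S.card, x' i = ∑ i ∈ S, x i ∧
      ((∀ i ∈ S, 0 ≤ x i) → ∀ i ∈ Finset.Icc 1 S.card, 0 ≤ x' i) ∧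
      AntitoneOn x' (Finset.Icc 1 S.card) := by
  classical
  obtain ⟨g, hbij, hanti⟩ := exists_antitone_enumeration S hS x
  have hinj := hbij.injOn
  have himg : (Finset.Icc 1 S.card).image g = S := by
    apply Finset.coe_injective
    rw [Finset.coe_image]
    exact hbij.image_eq
  set I := Finset.Icc 1 S.card with hI
  let E' := (I.powersetCard r).filter fun e => e.image g ∈ E
  have hsub : ∀ e ∈ E', e ⊆ I := fun e he =>
    (Finset.mem_powersetCard.1 (Finset.mem_filter.1 he).1).1
  have hmaps : ∀ e ∈ E', e.image g ∈ E := fun e he => (Finset.mem_filter.1 he).2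
  have hinjE : Set.InjOn (fun e : Finset ℕ => e.image g) (E' : Set (Finset ℕ)) := by
    intro e he e' he' h
    have h1 := hsub e he
    have h2 := hsub e' he'
    have h3 : e.image g = e'.image g := h
    have key : ∀ a b : Finset ℕ, a ⊆ I → b ⊆ I → a.image g = b.image g → a ⊆ b := by
      intro a b ha hb hab i hi
      have : g i ∈ b.image g := hab ▸ Finset.mem_image_of_mem g hi
      obtain ⟨j, hj, hji⟩ := Finset.mem_image.1 this
      rwa [← hinj (Finset.mem_coe.2 (hb hj)) (Finset.mem_coe.2 (ha hi)) hji]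
    exact (key _ _ h1 h2 h3).antisymm (key _ _ h2 h1 h3.symm)
  have hsurj : Set.SurjOn (fun e : Finset ℕ => e.image g) (E' : Set (Finset ℕ))
      (E : Set (Finset V)) := by
    intro e he
    obtain ⟨h1, h2⟩ := Finset.mem_powersetCard.1 (hE he)
    rw [← himg] at h1
    obtain ⟨s, hs, rfl⟩ := Finset.subset_image_iff.1 h1
    refine ⟨s, Finset.mem_coe.2 (Finset.mem_filter.2 ⟨Finset.mem_powersetCard.2 ⟨?_, ?_⟩, he⟩), rfl⟩
    · exact_mod_cast hs
    · rwa [Finset.card_image_of_injOn (hinj.mono (by exact_mod_cast hs))] at h2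
  refine ⟨E', fun i => x (g i), Finset.filter_subset _ _, ?_, ?_, ?_, ?_, hanti⟩
  · exact Finset.card_nbij _ hmaps hinjE hsurj
  · unfold edgeWeight
    refine Finset.sum_nbij _ hmaps hinjE hsurj fun e he => ?_
    rw [Finset.prod_image]
    exact hinj.mono (by exact_mod_cast hsub e he)
  · rw [← himg, Finset.sum_image hinj]
  · intro h i hi
    exact h _ (hbij.mapsTo (Finset.mem_coe.2 hi))

/-- `E` is a family of `m` triples in `[n]`, and `x` is a legal weighting of `[n]`. -/
structure IsFeasible (n m : ℕ) (E : Finset (Finset ℕ)) (x : ℕ → ℝ) : Prop where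
  subset : E ⊆ (Finset.Icc 1 n).powersetCard 3
  card : E.card = m
  nonneg : ∀ i ∈ Finset.Icc 1 n, 0 ≤ x i
  sum_eq : ∑ i ∈ Finset.Icc 1 n, x i = 1

/-- A pair of maximum weight among the feasible ones, with decreasing weights and
a left-compressed family. -/
structure IsOptimal (n m : ℕ) (E : Finset (Finset ℕ)) (x : ℕ → ℝ) : Prop
    extends IsFeasible n m E x where
  le : ∀ E' x', IsFeasible n m E' x' → edgeWeight E' x' ≤ edgeWeight E x
  antitone : AntitoneOn x (Finset.Icc 1 n)
  compressed : ∀ e ∈ E, ∀ i ∈ Finset.Icc 1 n, ∀ j ∈ e, i < j → i ∉ e →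
    insert i (e.erase j) ∈ E

theorem edgeWeight_swap {E : Finset (Finset ℕ)} {e e' : Finset ℕ} (he : e ∈ E) (he' : e' ∉ E)
    (x : ℕ → ℝ) : edgeWeight (insert e' (E.erase e)) x =
      edgeWeight E x - ∏ i ∈ e, x i + ∏ i ∈ e', x i := by
  unfold edgeWeight
  rw [Finset.sum_insert (fun h => he' (Finset.mem_of_mem_erase h)), ← Finset.sum_erase_add _ _ he]
  ring

theorem exists_isOptimal {n m : ℕ} (hn : 0 < n) (hm : m ≤ n.choose 3) :
    ∃ E x, IsOptimal n m E x := by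
  classical
  set I := Finset.Icc 1 n with hI
  set C := (I.powersetCard 3).powersetCard m with hC
  have hCne : C.Nonempty := by
    rw [hC]
    refine Finset.powersetCard_nonempty.2 ?_
    simpa [hI] using hm
  have hatt : ∀ E, ∃ x : ℕ → ℝ, E ∈ C → ((∀ i ∈ I, 0 ≤ x i) ∧ ∑ i ∈ I, x i = 1) ∧
      ∀ x' : ℕ → ℝ, (∀ i ∈ I, 0 ≤ x' i) → ∑ i ∈ I, x' i = 1 →
        edgeWeight E x' ≤ edgeWeight E x := by
    intro E
    by_cases hE : E ∈ C
    · let G : RGraph ℕ 3 := ⟨I, E, (Finset.mem_powersetCard.1 hE).1⟩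
      obtain ⟨⟨x, hx, hxe⟩, hub⟩ := G.isGreatest_lagrangian (Finset.nonempty_Icc.2 hn)
      refine ⟨x, fun _ => ⟨hx, fun x' h0 h1 => ?_⟩⟩
      have := hub ⟨x', ⟨h0, h1⟩, rfl⟩
      rw [hxe] at this
      exact this
    · exact ⟨0, fun h => absurd h hE⟩
  choose X hX using hatt
  obtain ⟨E₀, hE₀, hmax⟩ := Finset.exists_max_image C (fun E => edgeWeight E (X E)) hCne
  have hmem : ∀ E x, IsFeasible n m E x → E ∈ C := fun E x h =>
    Finset.mem_powersetCard.2 ⟨h.subset, h.card⟩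
  have hle : ∀ E' x', IsFeasible n m E' x' → edgeWeight E' x' ≤ edgeWeight E₀ (X E₀) := by
    intro E' x' h
    exact ((hX E' (hmem _ _ h)).2 x' h.nonneg h.sum_eq).trans (hmax E' (hmem _ _ h))
  obtain ⟨E₁, x, h1, h2, h3, h4, h5, h6⟩ := exists_relabel I (Finset.nonempty_Icc.2 hn) E₀
    (Finset.mem_powersetCard.1 hE₀).1 (X E₀)
  have hIc : I.card = n := by simp [hI]
  rw [hIc] at h1 h4 h5 h6
  have hx0 := h5 (hX E₀ hE₀).1.1
  have hx1 : ∑ i ∈ Finset.Icc 1 n, x i = 1 := h4.trans (hX E₀ hE₀).1.2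
  set L := edgeWeight E₀ (X E₀) with hL
  obtain ⟨E, hE, hmin⟩ := Finset.exists_min_image (C.filter fun E => edgeWeight E x = L)
    (fun E => ∑ e ∈ E, ∑ i ∈ e, i) ⟨E₁, Finset.mem_filter.2 ⟨Finset.mem_powersetCard.2
      ⟨h1, h2.trans (Finset.mem_powersetCard.1 hE₀).2⟩, h3⟩⟩
  obtain ⟨hEC, hEL⟩ := Finset.mem_filter.1 hE
  obtain ⟨hEs, hEc⟩ := Finset.mem_powersetCard.1 hEC
  refine ⟨E, x, ⟨⟨hEs, hEc, hx0, hx1⟩, fun E' x' h => (hle E' x' h).trans hEL.ge, h6, ?_⟩⟩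
  intro e he i hi j hj hij hie
  by_contra hne
  obtain ⟨hes, hec⟩ := Finset.mem_powersetCard.1 (hEs he)
  set e' := insert i (e.erase j) with he'
  have hi' : i ∉ e.erase j := fun h => hie (Finset.mem_of_mem_erase h)
  have hfeas : IsFeasible n m (insert e' (E.erase e)) x := by
    refine ⟨?_, ?_, hx0, hx1⟩
    · refine Finset.insert_subset (Finset.mem_powersetCard.2 ⟨?_, ?_⟩)
        ((Finset.erase_subset _ _).trans hEs)
      · exact Finset.insert_subset hi ((Finset.erase_subset _ _).trans hes)
      · rw [he', Finset.card_insert_of_notMem hi', Finset.card_erase_of_mem hj, hec]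
    · rw [Finset.card_insert_of_notMem (fun h => hne (Finset.mem_of_mem_erase h)),
        Finset.card_erase_of_mem he, hEc]
      have : 0 < E.card := Finset.card_pos.2 ⟨e, he⟩
      omega
  have hprod : ∏ k ∈ e, x k ≤ ∏ k ∈ e', x k := by
    rw [he', Finset.prod_insert hi', ← Finset.mul_prod_erase e x hj]
    refine mul_le_mul_of_nonneg_right (h6 (Finset.mem_coe.2 hi) (Finset.mem_coe.2 (hes hj)) hij.le)
      (Finset.prod_nonneg fun k hk => hx0 k (hes (Finset.mem_of_mem_erase hk)))
  have hw := edgeWeight_swap he hne x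
  have hEq : edgeWeight (insert e' (E.erase e)) x = L :=
    le_antisymm (hle _ _ hfeas) (by rw [hw, hEL]; linarith)
  have := hmin _ (Finset.mem_filter.2 ⟨hmem _ _ hfeas, hEq⟩)
  rw [Finset.sum_insert (fun h => hne (Finset.mem_of_mem_erase h)),
    ← Finset.add_sum_erase E _ he, he', Finset.sum_insert hi',
    ← Finset.add_sum_erase e _ hj] at this
  omega

theorem nonpos_of_mul_le_sq {α c ε : ℝ} (hε : 0 < ε)
    (h : ∀ s, 0 ≤ s → s ≤ ε → α * s ≤ c * s ^ 2) : α ≤ 0 := by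
  by_contra! hα
  have hc : 0 < 2 * (|c| + 1) := by positivity
  set s := min ε (α / (2 * (|c| + 1))) with hs
  have hs0 : 0 < s := lt_min hε (by positivity)
  have h1 := h s hs0.le (min_le_left _ _)
  have h2 : s * (2 * (|c| + 1)) ≤ α := (le_div_iff₀ hc).1 (min_le_right _ _)
  have h3 : α ≤ c * s := by
    by_contra! h3
    nlinarith
  nlinarith [le_abs_self c]

theorem eq_zero_of_mul_le_sq {α c ε : ℝ} (hε : 0 < ε)
    (h : ∀ s, -ε ≤ s → s ≤ ε → α * s ≤ c * s ^ 2) : α = 0 := by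
  refine le_antisymm (nonpos_of_mul_le_sq (c := c) hε fun s h0 h1 => h s (by linarith) h1) ?_
  have := nonpos_of_mul_le_sq (α := -α) (c := c) hε fun s h0 h1 => by
    have := h (-s) (by linarith) (by linarith)
    nlinarith
  linarith

/-- The elementary symmetric polynomials of degree two and three in five variables, the former
multiplied by `R`. -/
def fivePoly (R e a b c d : ℝ) : ℝ :=
  R * (e * a + e * b + e * c + e * d + a * b + a * c + a * d + b * c + b * d + c * d) +
    (e * a * b + e * a * c + e * a * d + e * b * c + e * b * d + e * c * d +
      a * b * c + a * b * d + a * c * d + b * c * d)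

/-- With `k = 0` or `k = 1/8` the weights `A + 1 - 2k` (three times) and `A - 1 - h + 3k` (twice)
are good enough; this is the resulting polynomial inequality. -/
theorem exists_shift {A h : ℝ} (hd : 0 < A - 1 - h) (hR : A + 2 - h ≤ A ^ 2 - 3 * A)
    (hA : 0 < A) (hh : h * ((A - 1) ^ 2 - h) = 2 * (A - 1)) (hp : 0 ≤ h + 1) :
    ∃ k, 0 ≤ k ∧ 0 ≤ A + 1 - 2 * k ∧ 0 ≤ (-3 * A * h ^ 2 + 6 * (A - 1 - h) - 3 * A + 1) +
      k * (-12 * A + 36 + h * (6 * A ^ 2 + 6 * A + 24)) +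
      k ^ 2 * (24 * (A - 1 - h) - 60 * (A + 1) - 15 * (A ^ 2 - 3 * A)) + 64 * k ^ 3 := by
  have hA1 : 3.7 ≤ A := by nlinarith
  have hh0 : 0 < h := by
    by_contra! h0
    nlinarith [mul_nonneg (neg_nonneg.2 h0) (show 0 ≤ (A - 1) ^ 2 - h by nlinarith)]
  have hup : h * (A - 2) ≤ 2 := by
    by_contra! h1
    nlinarith [mul_pos hh0 hd, mul_lt_mul_of_pos_left h1 (show (0 : ℝ) < A - 1 by linarith)]
  have hlow : 2 ≤ h * (A - 1) := by
    by_contra! h1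
    nlinarith [mul_lt_mul_of_pos_left h1 (show (0 : ℝ) < A - 1 by linarith)]
  have hh1 : h ≤ 1.2 := by nlinarith
  have hA2 : 4.1 ≤ A := by nlinarith
  rcases le_total 5 A with h5 | h5
  · refine ⟨0, le_rfl, by linarith, ?_⟩
    have h1 : h ≤ 2 / 3 := by nlinarith
    have h2 : h * (A - 1) ≤ 2.1 := by
      by_contra! h2
      nlinarith [mul_lt_mul_of_pos_left h2 (show (0 : ℝ) < A - 1 by linarith)]
    have h3 : h ≤ 0.525 := by nlinarith
    nlinarith [mul_le_mul_of_nonneg_left h2 hh0.le, mul_le_mul_of_nonneg_left h3 hh0.le]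
  · refine ⟨1 / 8, by norm_num, by linarith, ?_⟩
    have h1 : h ≤ 1 := by nlinarith
    have h2 : 1 / 2 ≤ h := by nlinarith
    nlinarith [mul_nonneg (sub_nonneg.2 hlow) (sub_nonneg.2 hup), mul_nonneg (sub_nonneg.2 h1) (sub_nonneg.2 h2), mul_nonneg (sub_nonneg.2 hA2) (sub_nonneg.2 h5)]

theorem critical_relations {R e a d : ℝ} (hR : R = 0 ∨ e ≤ R) (hea : a ≤ e) (had : d ≤ a)
    (hd : 0 < d) (h1 : (e - a) * (R + d + 2 * a) = 2 * a * d)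
    (h2 : (e - d) * (R + 3 * a) = 3 * a ^ 2) :
    ∃ g y, 0 ≤ g ∧ 0 ≤ y ∧ 3 * g + 2 * y = e + 3 * a + d ∧
      fivePoly R e a a a d - 3 * a * a * d ≤ fivePoly R g g g y y - 3 * g * y * y := by
  have ha : 0 < a := by linarith
  have hed : 0 < e - d := by
    by_contra! h
    have : 0 ≤ R + 3 * a := by rcases hR with h | h <;> linarith
    nlinarith [mul_nonneg (neg_nonneg.2 h) this, pow_pos ha 2]
  rcases hR with rfl | hR
  · have : e = a + d := by
      have : 3 * a * (e - d - a) = 0 := by linarith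
      rcases mul_eq_zero.1 this with h | h <;> linarith
    subst this
    nlinarith [mul_pos hd hd]
  obtain ⟨δ, hδ⟩ : ∃ δ, δ = (e - d) / 3 := ⟨_, rfl⟩
  have hδ0 : 0 < δ := by rw [hδ]; linarith
  obtain ⟨A, rfl⟩ : ∃ A, a = δ * A := ⟨a / δ, by field_simp⟩
  obtain ⟨h, hh⟩ : ∃ h, d = δ * (A - 1 - h) := ⟨A - 1 - d / δ, by field_simp; ring⟩
  have he : e = δ * (A + 2 - h) := by linarith
  have hRA : R = δ * (A ^ 2 - 3 * A) := by
    have : 3 * δ * (R + 3 * (δ * A)) = 3 * δ * (δ * A ^ 2) := by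
      linear_combination h2 + (R + 3 * (δ * A)) * (3 * hδ)
    have := mul_left_cancel₀ (by positivity) this
    linarith
  subst hh he hRA
  have hA : 0 < A := pos_of_mul_pos_right ha hδ0.le
  have hrel : h * ((A - 1) ^ 2 - h) = 2 * (A - 1) := by
    have : δ ^ 2 * (h * ((A - 1) ^ 2 - h)) = δ ^ 2 * (2 * (A - 1)) := by linarith
    exact mul_left_cancel₀ (by positivity) this
  obtain ⟨k, hk0, hk1, hk⟩ := exists_shift (pos_of_mul_pos_right hd hδ0.le)
    (le_of_mul_le_mul_left hR hδ0) hA hrel (by nlinarith [le_of_mul_le_mul_left had hδ0])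
  refine ⟨δ * (A + 1 - 2 * k), δ * (A - 1 - h + 3 * k), by positivity, ?_, by ring, ?_⟩
  · have := pos_of_mul_pos_right hd hδ0.le
    positivity
  · have := mul_nonneg (pow_pos hδ0 3).le hk
    unfold fivePoly
    linarith

/-- A maximum of the polynomial in which the triples `abd`, `acd`, `bcd` are left out is at most
the maximum of the one in which `ecd`, `acd`, `bcd` are left out. -/
theorem exists_fivePoly_ge {R e a b c d : ℝ} (hR : R = 0 ∨ e ≤ R) (hea : a ≤ e) (hab : b ≤ a)
    (hbc : c ≤ b) (hcd : d ≤ c) (hd : 0 < d)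
    (H : ∀ e' a' b' c' d', 0 ≤ e' → 0 ≤ a' → 0 ≤ b' → 0 ≤ c' → 0 ≤ d' →
      e' + a' + b' + c' + d' = e + a + b + c + d →
      fivePoly R e' a' b' c' d' - (a' * b' * d' + a' * c' * d' + b' * c' * d') ≤
        fivePoly R e a b c d - (a * b * d + a * c * d + b * c * d)) :
    ∃ g y, 0 ≤ g ∧ 0 ≤ y ∧ 3 * g + 2 * y = e + a + b + c + d ∧
      fivePoly R e a b c d - (a * b * d + a * c * d + b * c * d) ≤
        fivePoly R g g g y y - 3 * g * y * y := by
  have hR0 : 0 ≤ R := by rcases hR with h | h <;> linarith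
  have h1 : a = b := by
    have := H e ((a + b) / 2) ((a + b) / 2) c d (by linarith) (by linarith) (by linarith)
      (by linarith) hd.le (by ring)
    unfold fivePoly at this
    have h3 : (a - b) ^ 2 * (R + c + e) ≤ 0 := by linarith
    have h4 : (a - b) ^ 2 ≤ 0 := by
      by_contra! h4
      nlinarith [mul_pos h4 (show 0 < R + c + e by linarith)]
    nlinarith
  subst h1
  have h1 : a = c := by
    have := H e a ((a + c) / 2) ((a + c) / 2) d (by linarith) (by linarith) (by linarith)
      (by linarith) hd.le (by ring)
    unfold fivePoly at this
    have h3 : (a - c) ^ 2 * (R + a + e) ≤ 0 := by linarith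
    have h4 : (a - c) ^ 2 ≤ 0 := by
      by_contra! h4
      nlinarith [mul_pos h4 (show 0 < R + a + e by linarith)]
    nlinarith
  subst h1
  have hcrit1 : (e - a) * (R + d + 2 * a) - 2 * a * d = 0 := by
    refine eq_zero_of_mul_le_sq (c := R + 2 * a + d) hd fun s hs1 hs2 => ?_
    have := H (e - s) (a + s) a a d (by linarith) (by linarith) (by linarith)
      (by linarith) hd.le (by ring)
    unfold fivePoly at this
    linarith
  have hcrit2 : (e - d) * (R + 3 * a) - 3 * a ^ 2 = 0 := by
    refine eq_zero_of_mul_le_sq (c := R + 3 * a) hd fun s hs1 hs2 => ?_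
    have := H (e - s) a a a (d + s) (by linarith) (by linarith) (by linarith)
      (by linarith) (by linarith) (by ring)
    unfold fivePoly at this
    linarith
  obtain ⟨g, y, hg, hy, hs, hle⟩ := critical_relations hR hea hcd hd (by linarith) (by linarith)
  exact ⟨g, y, hg, hy, by linarith, by linarith⟩

/-- The sum over the edges through `i` avoiding `j` of the product of the other weights. -/
def linkSum (E : Finset (Finset ℕ)) (x : ℕ → ℝ) (i j : ℕ) : ℝ :=
  ∑ e ∈ E with i ∈ e ∧ j ∉ e, ∏ k ∈ e.erase i, x k

/-- The sum over the edges through `i` and `j` of the product of the other weights. -/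
def pairLinkSum (E : Finset (Finset ℕ)) (x : ℕ → ℝ) (i j : ℕ) : ℝ :=
  ∑ e ∈ E with i ∈ e ∧ j ∈ e, ∏ k ∈ (e.erase i).erase j, x k

/-- The weight of the edges avoiding `i` and `j`. -/
def avoidSum (E : Finset (Finset ℕ)) (x : ℕ → ℝ) (i j : ℕ) : ℝ :=
  ∑ e ∈ E with i ∉ e ∧ j ∉ e, ∏ k ∈ e, x k

theorem edgeWeight_split (E : Finset (Finset ℕ)) (x : ℕ → ℝ) {i j : ℕ} (hij : i ≠ j) :
    edgeWeight E x = x i * linkSum E x i j + x j * linkSum E x j i +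
      x i * x j * pairLinkSum E x i j + avoidSum E x i j := by
  unfold edgeWeight linkSum pairLinkSum avoidSum
  simp only [Finset.mul_sum, Finset.sum_filter, ← Finset.sum_add_distrib]
  refine Finset.sum_congr rfl fun e _ => ?_
  by_cases hi : i ∈ e <;> by_cases hj : j ∈ e
  · have hj' : j ∈ e.erase i := Finset.mem_erase.2 ⟨hij.symm, hj⟩
    simp [hi, hj, ← Finset.mul_prod_erase e x hi, ← Finset.mul_prod_erase _ x hj', mul_assoc]
  · simp [hi, hj, ← Finset.mul_prod_erase e x hi]
  · simp [hi, hj, ← Finset.mul_prod_erase e x hj]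
  · simp [hi, hj]

section Congr

variable {E : Finset (Finset ℕ)} {x y : ℕ → ℝ} {i j : ℕ}

theorem linkSum_congr (h : ∀ k, k ≠ i → k ≠ j → x k = y k) :
    linkSum E x i j = linkSum E y i j := by
  refine Finset.sum_congr rfl fun e he => Finset.prod_congr rfl fun k hk => ?_
  refine h k (Finset.ne_of_mem_erase hk) ?_
  rintro rfl
  exact (Finset.mem_filter.1 he).2.2 (Finset.mem_of_mem_erase hk)

theorem pairLinkSum_congr (h : ∀ k, k ≠ i → k ≠ j → x k = y k) :
    pairLinkSum E x i j = pairLinkSum E y i j := by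
  refine Finset.sum_congr rfl fun e _ => Finset.prod_congr rfl fun k hk => ?_
  exact h k (Finset.ne_of_mem_erase (Finset.mem_of_mem_erase hk)) (Finset.ne_of_mem_erase hk)

theorem avoidSum_congr (h : ∀ k, k ≠ i → k ≠ j → x k = y k) :
    avoidSum E x i j = avoidSum E y i j := by
  refine Finset.sum_congr rfl fun e he => Finset.prod_congr rfl fun k hk => ?_
  have := (Finset.mem_filter.1 he).2
  exact h k (by rintro rfl; exact this.1 hk) (by rintro rfl; exact this.2 hk)

end Congr

theorem IsOptimal.link_le {n m : ℕ} {E : Finset (Finset ℕ)} {x : ℕ → ℝ} (h : IsOptimal n m E x)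
    {i j : ℕ} (hi : i ∈ Finset.Icc 1 n) (hj : j ∈ Finset.Icc 1 n) (hij : i ≠ j) (hx : 0 < x i) :
    linkSum E x j i + pairLinkSum E x i j * x i ≤
      linkSum E x i j + pairLinkSum E x i j * x j := by
  have key := nonpos_of_mul_le_sq (α := linkSum E x j i + pairLinkSum E x i j * x i -
    (linkSum E x i j + pairLinkSum E x i j * x j)) (c := pairLinkSum E x i j) hx ?_
  · linarith
  intro s hs0 hs1
  let y : ℕ → ℝ := fun k => x k + (if k = j then s else 0) - (if k = i then s else 0)
  have hyi : y i = x i - s := by simp [y, hij]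
  have hyj : y j = x j + s := by simp [y, hij.symm]
  have hy : ∀ k, k ≠ i → k ≠ j → y k = x k := fun k h1 h2 => by simp [y, h1, h2]
  have hf : IsFeasible n m E y := by
    refine ⟨h.subset, h.card, fun k hk => ?_, ?_⟩
    · have := h.nonneg k hk
      by_cases h1 : k = i
      · subst h1; rw [hyi]; linarith
      by_cases h2 : k = j
      · subst h2; rw [hyj]; linarith
      rwa [hy k h1 h2]
    · simp only [y, Finset.sum_sub_distrib, Finset.sum_add_distrib, Finset.sum_ite_eq', hi, hj,
        if_true, h.sum_eq]
      ring
  have := h.le E y hf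
  rw [edgeWeight_split E y hij, edgeWeight_split E x hij, linkSum_congr hy,
    linkSum_congr (i := j) (j := i) fun k h1 h2 => hy k h2 h1, pairLinkSum_congr hy,
    avoidSum_congr hy, hyi, hyj] at this
  nlinarith

theorem pairLinkSum_eq {n : ℕ} {E : Finset (Finset ℕ)}
    (hE : E ⊆ (Finset.Icc 1 n).powersetCard 3) (x : ℕ → ℝ) {i j : ℕ} (hij : i ≠ j) :
    pairLinkSum E x i j =
      ∑ p ∈ Finset.Icc 1 n with p ≠ i ∧ p ≠ j ∧ ({p, i, j} : Finset ℕ) ∈ E, x p := by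
  symm
  have herase : ∀ p, p ≠ i → p ≠ j → (({p, i, j} : Finset ℕ).erase i).erase j = {p} := by
    intro p h1 h2
    ext q
    simp only [Finset.mem_erase, Finset.mem_insert, Finset.mem_singleton]
    grind
  refine Finset.sum_nbij (fun p => ({p, i, j} : Finset ℕ)) ?_ ?_ ?_ ?_
  · intro p hp
    simp only [Finset.mem_filter] at hp ⊢
    exact ⟨hp.2.2.2, by simp, by simp⟩
  · intro p hp q hq hpq
    simp only [Finset.coe_filter, Set.mem_ofPred_eq] at hp hq
    have h1 : p ∈ ({q, i, j} : Finset ℕ) := by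
      rw [← show ({p, i, j} : Finset ℕ) = {q, i, j} from hpq]; simp
    simp only [Finset.mem_insert, Finset.mem_singleton] at h1
    tauto
  · intro e he
    simp only [Finset.coe_filter, Set.mem_ofPred_eq] at he
    obtain ⟨he, hi, hj⟩ := he
    obtain ⟨hs, hc⟩ := Finset.mem_powersetCard.1 (hE he)
    have hj' : j ∈ e.erase i := Finset.mem_erase.2 ⟨hij.symm, hj⟩
    have hc1 : ((e.erase i).erase j).card = 1 := by
      rw [Finset.card_erase_of_mem hj', Finset.card_erase_of_mem hi, hc]
    obtain ⟨p, hp⟩ := Finset.card_eq_one.1 hc1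
    have hp' : p ∈ (e.erase i).erase j := by rw [hp]; simp
    simp only [Finset.mem_erase] at hp'
    have hee : ({p, i, j} : Finset ℕ) = e := by
      rw [← Finset.insert_erase hi, ← Finset.insert_erase hj', hp]
      ext q
      simp only [Finset.mem_insert, Finset.mem_singleton]
      tauto
    refine ⟨p, ?_, hee⟩
    simp only [Finset.coe_filter, Set.mem_ofPred_eq]
    exact ⟨hs hp'.2.2, hp'.2.1, hp'.1, hee ▸ he⟩
  · intro p hp
    simp only [Finset.mem_filter] at hp
    rw [herase p hp.2.1 hp.2.2.1, Finset.prod_singleton]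

theorem linkSum_eq {n : ℕ} {E : Finset (Finset ℕ)}
    (hE : E ⊆ (Finset.Icc 1 n).powersetCard 3) (x : ℕ → ℝ) {i j : ℕ} (hij : i ≠ j) :
    linkSum E x i j =
      ∑ a ∈ (((Finset.Icc 1 n).erase i).erase j).powersetCard 2 with insert i a ∈ E,
        ∏ k ∈ a, x k := by
  refine Finset.sum_nbij' (fun e => e.erase i) (fun a => insert i a) ?_ ?_ ?_ ?_ ?_
  · intro e he
    obtain ⟨he, hi, hj⟩ := Finset.mem_filter.1 he
    obtain ⟨hs, hc⟩ := Finset.mem_powersetCard.1 (hE he)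
    refine Finset.mem_filter.2 ⟨Finset.mem_powersetCard.2 ⟨fun k hk => ?_, ?_⟩, ?_⟩
    · obtain ⟨h1, h2⟩ := Finset.mem_erase.1 hk
      simp only [Finset.mem_erase]
      exact ⟨by rintro rfl; exact hj h2, h1, hs h2⟩
    · rw [Finset.card_erase_of_mem hi, hc]
    · rwa [Finset.insert_erase hi]
  · intro a ha
    obtain ⟨ha, hE'⟩ := Finset.mem_filter.1 ha
    obtain ⟨hs, hc⟩ := Finset.mem_powersetCard.1 ha
    refine Finset.mem_filter.2 ⟨hE', by simp, ?_⟩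
    intro hj
    rcases Finset.mem_insert.1 hj with h | h
    · exact hij h.symm
    · exact absurd rfl (Finset.mem_erase.1 (hs h)).1
  · intro e he
    exact Finset.insert_erase (Finset.mem_filter.1 he).2.1
  · intro a ha
    refine Finset.erase_insert fun hi => ?_
    have := (Finset.mem_powersetCard.1 (Finset.mem_filter.1 ha).1).1 hi
    simp at this
  · intro e _
    rfl

theorem exists_subset_card_mul_sum_le {ι : Type*} (S : Finset ι) (f : ι → ℝ) {k : ℕ}
    (hk : k ≤ S.card) : ∃ T ⊆ S, T.card = k ∧ k * ∑ i ∈ S, f i ≤ S.card * ∑ i ∈ T, f i := by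
  classical
  induction hd : S.card - k generalizing S with
  | zero => exact ⟨S, subset_rfl, by omega, by rw [show k = S.card by omega]⟩
  | succ d ih =>
    have hne : S.Nonempty := Finset.card_pos.1 (by omega)
    obtain ⟨a, ha, hmin⟩ := Finset.exists_min_image S f hne
    have hc := Finset.card_erase_of_mem ha
    obtain ⟨T, hTS, hT, hle⟩ := ih (S.erase a) (by omega) (by omega)
    refine ⟨T, hTS.trans (Finset.erase_subset _ _), hT, ?_⟩
    have h1 := Finset.add_sum_erase S f ha
    have h2 : (T.card : ℝ) * f a ≤ ∑ i ∈ T, f i := by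
      rw [← nsmul_eq_mul]
      exact Finset.card_nsmul_le_sum _ _ _ fun i hi => hmin i (Finset.mem_of_mem_erase (hTS hi))
    have h3 : ((S.erase a).card : ℝ) = S.card - 1 := by
      rw [hc, Nat.cast_sub (by omega)]; simp
    rw [h3] at hle
    rw [hT] at h2
    have : ∑ i ∈ S.erase a, f i = ∑ i ∈ S, f i - f a := by linarith
    rw [this] at hle
    linarith

/-- The loss caused by dropping the last vertex is made up for by `N` new triples containing the
last but one; `G` is the sum of the products of the other two weights in these. -/
theorem loss_le_of_many {u v x₁ c₁ D G N K b q : ℝ} (hv : 0 < v) (huv : v ≤ u) (hb0 : 0 ≤ b)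
    (hq : 0 < q) (hD : 0 ≤ D) (hc₁ : q * v ≤ c₁) (hx₁ : (x₁ - u - v) * c₁ ≤ D) (hK : 0 < K)
    (hG : N * u ^ 2 ≤ G) (hDG : N * D ≤ K * G) (hN : 2 * b ≤ N) (hbK : b * K ≤ N * q) :
    b * x₁ * v ^ 2 ≤ (u + v) * G := by
  have h1 : (x₁ - u - v) * (q * v) ≤ D := by
    rcases le_total (x₁ - u - v) 0 with h | h
    · nlinarith [mul_nonneg (neg_nonneg.2 h) (mul_nonneg hq.le hv.le)]
    · exact (mul_le_mul_of_nonneg_left hc₁ h).trans hx₁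
  have h2 : q * (b * x₁ * v ^ 2) ≤ q * (b * (u + v) * v ^ 2) + b * v * D := by
    have := mul_le_mul_of_nonneg_left h1 (mul_nonneg hb0 hv.le)
    linarith
  have h3 : b * v * D ≤ q * v * G := by
    have h4 := mul_le_mul_of_nonneg_right hbK (mul_nonneg hv.le hD)
    have h5 := mul_le_mul_of_nonneg_left hDG (mul_nonneg hq.le hv.le)
    refine le_of_mul_le_mul_left ?_ hK
    linarith
  have hu : 0 < u := hv.trans_le huv
  have h4 : b * (u + v) * v ^ 2 ≤ u * G := by
    have h5 : (u + v) * v ^ 2 ≤ 2 * u ^ 3 := by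
      have := pow_le_pow_left₀ hv.le huv 2
      nlinarith
    have h6 := mul_le_mul_of_nonneg_left h5 hb0
    have h7 := mul_le_mul_of_nonneg_right hN (pow_nonneg hu.le 3)
    have h8 := mul_le_mul_of_nonneg_left hG hu.le
    linarith
  refine le_of_mul_le_mul_left ?_ hq
  have := mul_le_mul_of_nonneg_left h4 hq.le
  linarith

/-- The variant of `loss_le_of_many` in which all `K ≤ N` triples containing the last but one
vertex are added, together with `N - K` others. -/
theorem loss_le_of_few {u v x₁ c₁ D N K b q : ℝ} (hv : 0 < v) (huv : v ≤ u) (hb0 : 0 ≤ b)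
    (hq : 0 < q) (hD : 0 ≤ D) (hc₁ : q * v ≤ c₁) (hx₁ : (x₁ - u - v) * c₁ ≤ D)
    (hG : K * u ^ 2 ≤ D) (hN : 2 * b ≤ N) (hbq : b ≤ q) :
    b * x₁ * v ^ 2 ≤ (u + v) * D + (N - K) * u ^ 3 := by
  have h1 : (x₁ - u - v) * (q * v) ≤ D := by
    rcases le_total (x₁ - u - v) 0 with h | h
    · nlinarith [mul_nonneg (neg_nonneg.2 h) (mul_nonneg hq.le hv.le)]
    · exact (mul_le_mul_of_nonneg_left hc₁ h).trans hx₁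
  have h2 : q * (b * x₁ * v ^ 2) ≤ q * (b * (u + v) * v ^ 2) + b * v * D := by
    have := mul_le_mul_of_nonneg_left h1 (mul_nonneg hb0 hv.le)
    linarith
  have h3 : b * v * D ≤ q * v * D := by
    have := mul_le_mul_of_nonneg_right hbq (mul_nonneg hv.le hD)
    linarith
  have hu : 0 < u := hv.trans_le huv
  have h4 : b * (u + v) * v ^ 2 ≤ u * D + (N - K) * u ^ 3 := by
    have h5 : (u + v) * v ^ 2 ≤ 2 * u ^ 3 := by
      have := pow_le_pow_left₀ hv.le huv 2
      nlinarith
    have h6 := mul_le_mul_of_nonneg_left h5 hb0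
    have h7 := mul_le_mul_of_nonneg_right hN (pow_nonneg hu.le 3)
    have h8 := mul_le_mul_of_nonneg_left hG hu.le
    linarith
  refine le_of_mul_le_mul_left ?_ hq
  have := mul_le_mul_of_nonneg_left h4 hq.le
  linarith

section Compressed

variable {n m : ℕ} {E : Finset (Finset ℕ)} {x : ℕ → ℝ}

theorem IsOptimal.mem_of_mem_pair (h : IsOptimal (n + 1) m E x) {p q : ℕ}
    (hpn : p < n) (hpE : ({p, n, n + 1} : Finset ℕ) ∈ E) (hq : 1 ≤ q) (hqn : q ≤ n)
    (hqp : q ≠ p) : ({p, q, n + 1} : Finset ℕ) ∈ E := by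
  rcases hqn.eq_or_lt with rfl | hqn
  · exact hpE
  have := h.compressed _ hpE q (Finset.mem_Icc.2 ⟨hq, by omega⟩) n (by simp) hqn
    (by simp; omega)
  convert this using 1
  ext k
  simp only [Finset.mem_insert, Finset.mem_erase, Finset.mem_singleton]
  omega

theorem IsOptimal.one_mem_of_mem_pair (h : IsOptimal (n + 1) m E x) {p : ℕ} (hp : 1 ≤ p)
    (hpn : p < n) (hpE : ({p, n, n + 1} : Finset ℕ) ∈ E) :
    ({1, n, n + 1} : Finset ℕ) ∈ E := by
  rcases hp.eq_or_lt with rfl | hp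
  · exact hpE
  have := h.compressed _ hpE 1 (Finset.mem_Icc.2 ⟨le_rfl, by omega⟩) p (by simp) hp
    (by simp; omega)
  convert this using 1
  ext k
  simp only [Finset.mem_insert, Finset.mem_erase, Finset.mem_singleton]
  omega

theorem IsOptimal.one_link_full (h : IsOptimal (n + 1) m E x) (hn : 2 ≤ n)
    (hE : ({1, n, n + 1} : Finset ℕ) ∈ E) {p q : ℕ} (hp : 1 < p) (hpn : p ≤ n) (hq : 1 < q)
    (hqn : q ≤ n + 1) (hpq : p ≠ q) : ({1, p, q} : Finset ℕ) ∈ E := by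
  have h1 := h.mem_of_mem_pair (by omega) hE hp.le hpn hp.ne'
  rcases hqn.eq_or_lt with rfl | hqn
  · exact h1
  have := h.compressed _ h1 q (Finset.mem_Icc.2 ⟨hq.le, by omega⟩) (n + 1) (by simp) hqn
    (by simp; omega)
  convert this using 1
  ext k
  simp only [Finset.mem_insert, Finset.mem_erase, Finset.mem_singleton]
  omega

/-- The number of edges through the last vertex, compared with its common degree with the last but
one. -/
theorem IsOptimal.card_mul_le (h : IsOptimal (n + 1) m E x) :
    ((Finset.Icc 1 (n - 1)).filter fun p => ({p, n, n + 1} : Finset ℕ) ∈ E).card * (n - 1) ≤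
      (E.filter fun e => n + 1 ∈ e).card * 2 := by
  refine Finset.card_mul_le_card_mul (fun (p : ℕ) (e : Finset ℕ) => p ∈ e) ?_ ?_
  · intro p hp
    obtain ⟨hp, hpE⟩ := Finset.mem_filter.1 hp
    rw [Finset.mem_Icc] at hp
    have hc : ((Finset.Icc 1 n).erase p).card = n - 1 := by
      rw [Finset.card_erase_of_mem (Finset.mem_Icc.2 ⟨hp.1, by omega⟩)]
      simp
    rw [← hc]
    refine Finset.card_le_card_of_injOn (fun q => ({p, q, n + 1} : Finset ℕ)) ?_ ?_
    · intro q hq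
      simp only [Finset.coe_erase, Set.mem_sdiff, Finset.mem_coe, Finset.mem_Icc,
        Set.mem_singleton_iff] at hq
      simp only [Finset.bipartiteAbove, Finset.coe_filter, Set.mem_ofPred_eq, Finset.mem_filter]
      exact ⟨⟨h.mem_of_mem_pair (by omega) hpE hq.1.1 hq.1.2 hq.2, by simp⟩, by simp⟩
    · intro q hq q' hq' hqq
      simp only [Finset.coe_erase, Set.mem_sdiff, Finset.mem_coe, Finset.mem_Icc,
        Set.mem_singleton_iff] at hq hq'
      have h1 : q ∈ ({p, q', n + 1} : Finset ℕ) := by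
        rw [← show ({p, q, n + 1} : Finset ℕ) = {p, q', n + 1} from hqq]; simp
      simp only [Finset.mem_insert, Finset.mem_singleton] at h1
      omega
  · intro e he
    obtain ⟨he, hne⟩ := Finset.mem_filter.1 he
    have hc : (e.erase (n + 1)).card = 2 := by
      rw [Finset.card_erase_of_mem hne, (Finset.mem_powersetCard.1 (h.subset he)).2]
    rw [← hc]
    refine Finset.card_le_card fun p hp => ?_
    obtain ⟨hp, hpe⟩ := Finset.mem_filter.1 hp
    have := Finset.mem_Icc.1 (Finset.mem_filter.1 hp).1
    exact Finset.mem_erase.2 ⟨by omega, hpe⟩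

/-- The largest weight exceeds the sum of the two smallest ones only if there are many missing
triples through the last but one vertex. -/
theorem IsOptimal.first_weight_bound (h : IsOptimal (n + 1) m E x) (hn : 3 ≤ n)
    (hE : ({1, n, n + 1} : Finset ℕ) ∈ E) (hx : 0 < x (n + 1)) :
    (x 1 - x n - x (n + 1)) * (∑ p ∈ Finset.Icc 2 (n - 1), x p + x (n + 1)) ≤
      ∑ a ∈ (Finset.Icc 2 (n - 1)).powersetCard 2 with insert n a ∉ E, ∏ k ∈ a, x k := by
  have hI : ∀ {i}, 1 ≤ i → i ≤ n + 1 → i ∈ Finset.Icc 1 (n + 1) := fun h1 h2 =>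
    Finset.mem_Icc.2 ⟨h1, h2⟩
  have hpos : ∀ i, 1 ≤ i → i ≤ n + 1 → 0 < x i := fun i h1 h2 =>
    hx.trans_le (h.antitone (hI h1 h2) (hI (by omega) le_rfl) h2)
  set S := Finset.Icc 2 (n - 1) with hS
  have hnS : n + 1 ∉ S := by simp [hS]
  have hset : ((Finset.Icc 1 (n + 1)).erase 1).erase n = insert (n + 1) S := by
    ext k
    simp only [hS, Finset.mem_erase, Finset.mem_Icc, Finset.mem_insert]
    omega
  have hset' : ((Finset.Icc 1 (n + 1)).erase n).erase 1 = insert (n + 1) S := by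
    rw [Finset.erase_right_comm, hset]
  have hc : pairLinkSum E x 1 n = ∑ p ∈ S, x p + x (n + 1) := by
    rw [pairLinkSum_eq h.subset x (by omega), add_comm (∑ p ∈ S, x p), ← Finset.sum_insert hnS, ← hset]
    refine Finset.sum_congr ?_ fun _ _ => rfl
    ext p
    simp only [Finset.mem_filter, Finset.mem_erase, Finset.mem_Icc]
    constructor
    · rintro ⟨h1, h2, h3, -⟩
      exact ⟨h3, h2, h1⟩
    · rintro ⟨h3, h2, h1⟩
      refine ⟨h1, h2, h3, ?_⟩
      have := h.one_link_full (by omega) hE (p := n) (q := p) (by omega) le_rfl (by omega) h1.2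
        (Ne.symm h3)
      convert this using 1
      ext k
      simp only [Finset.mem_insert, Finset.mem_singleton]
      omega
  set U := (insert (n + 1) S).powersetCard 2 with hU
  have hprod : ∀ a ∈ U, 0 ≤ ∏ k ∈ a, x k := by
    intro a ha
    refine Finset.prod_nonneg fun k hk => (hpos k ?_ ?_).le <;>
    · have := (Finset.mem_powersetCard.1 ha).1 hk
      simp only [hS, Finset.mem_insert, Finset.mem_Icc] at this
      omega
  have hA : linkSum E x 1 n - linkSum E x n 1 ≤ ∑ a ∈ U with insert n a ∉ E, ∏ k ∈ a, x k := by
    rw [linkSum_eq h.subset x (show 1 ≠ n by omega), linkSum_eq h.subset x (show n ≠ 1 by omega),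
      hset, hset']
    have h1 : ∑ a ∈ U with insert 1 a ∈ E, ∏ k ∈ a, x k ≤ ∑ a ∈ U, ∏ k ∈ a, x k :=
      Finset.sum_le_sum_of_subset_of_nonneg (Finset.filter_subset _ _) fun a ha _ => hprod a ha
    have h2 := Finset.sum_filter_add_sum_filter_not U (fun a => insert n a ∈ E)
      fun a => ∏ k ∈ a, x k
    linarith
  have hsplit : ∑ a ∈ U with insert n a ∉ E, ∏ k ∈ a, x k ≤
      ∑ a ∈ S.powersetCard 2 with insert n a ∉ E, ∏ k ∈ a, x k +
        x (n + 1) * (∑ p ∈ S, x p) := by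
    have himg : ∑ a ∈ (S.powersetCard 1).image (insert (n + 1)), ∏ k ∈ a, x k =
        x (n + 1) * ∑ p ∈ S, x p := by
      rw [Finset.sum_image, Finset.mul_sum]
      · rw [Finset.powersetCard_one, Finset.sum_map]
        refine Finset.sum_congr rfl fun p hp => ?_
        have : n + 1 ∉ ({p} : Finset ℕ) := by
          rw [Finset.mem_singleton]; rintro rfl; exact hnS hp
        simp only [Function.Embedding.coeFn_mk]
        rw [Finset.prod_insert this, Finset.prod_singleton]
      · intro a ha b hb hab
        have ha' : n + 1 ∉ a := fun h => hnS ((Finset.mem_powersetCard.1 ha).1 h)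
        have hb' : n + 1 ∉ b := fun h => hnS ((Finset.mem_powersetCard.1 hb).1 h)
        rw [← Finset.erase_insert ha', ← Finset.erase_insert hb']
        exact congrArg (fun s => Finset.erase s (n + 1)) hab
    rw [← himg, hU, Finset.powersetCard_succ_insert hnS, Finset.filter_union]
    have hsub : ∀ a ∈ (S.powersetCard 1).image (insert (n + 1)), a ∈ U := by
      intro a ha
      rw [hU, Finset.powersetCard_succ_insert hnS]
      exact Finset.mem_union_right _ ha
    rw [Finset.sum_union]
    · exact add_le_add le_rfl (Finset.sum_le_sum_of_subset_of_nonneg (Finset.filter_subset _ _)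
        fun a ha _ => hprod a (hsub a ha))
    · refine Finset.disjoint_left.2 fun a ha hb => ?_
      obtain ⟨b, -, rfl⟩ := Finset.mem_image.1 (Finset.mem_filter.1 hb).1
      exact hnS ((Finset.mem_powersetCard.1 (Finset.mem_filter.1 ha).1).1
        (Finset.mem_insert_self _ _))
  have hl := h.link_le (hI le_rfl (by omega)) (hI (by omega) (by omega)) (show 1 ≠ n by omega)
    (hpos 1 le_rfl (by omega))
  rw [hc] at hl
  nlinarith [mul_pos hx hx]

end Compressed

section Descent

variable {n m : ℕ} {E : Finset (Finset ℕ)} {x : ℕ → ℝ}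

/-- The weighting in which vertex `n` has taken over the weight of vertex `n + 1`. -/
def mergeLast (n : ℕ) (x : ℕ → ℝ) : ℕ → ℝ := fun k =>
  if k = n then x n + x (n + 1) else if k = n + 1 then 0 else x k

theorem mergeLast_of_ne {k : ℕ} (h : k ≠ n) (h' : k ≠ n + 1) : mergeLast n x k = x k := by
  simp [mergeLast, h, h']

theorem mergeLast_self : mergeLast n x n = x n + x (n + 1) := by simp [mergeLast]

theorem mergeLast_succ : mergeLast n x (n + 1) = 0 := by simp [mergeLast]

theorem IsOptimal.edgeWeight_le_mergeLast (h : IsOptimal (n + 1) m E x) (hn : 1 ≤ n) :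
    edgeWeight E x ≤
      edgeWeight E (mergeLast n x) + pairLinkSum E x n (n + 1) * x (n + 1) ^ 2 := by
  have hne : n ≠ n + 1 := by omega
  have hy : ∀ k, k ≠ n → k ≠ n + 1 → mergeLast n x k = x k := fun k => mergeLast_of_ne
  have hIn : n ∈ Finset.Icc 1 (n + 1) := Finset.mem_Icc.2 ⟨hn, by omega⟩
  have hIn' : n + 1 ∈ Finset.Icc 1 (n + 1) := Finset.mem_Icc.2 ⟨by omega, le_rfl⟩
  have hv0 := h.nonneg _ hIn'
  have huv : x (n + 1) ≤ x n := h.antitone hIn hIn' (by omega)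
  rw [edgeWeight_split E (mergeLast n x) hne, edgeWeight_split E x hne, linkSum_congr hy,
    linkSum_congr (i := n + 1) (j := n) fun k h1 h2 => hy k h2 h1, pairLinkSum_congr hy,
    avoidSum_congr hy, mergeLast_self, mergeLast_succ]
  rcases hv0.eq_or_lt with hv | hv
  · rw [← hv]
    linarith
  · have := mul_le_mul_of_nonneg_left (h.link_le hIn hIn' hne (hv.trans_le huv)) hv0
    linarith

theorem edgeWeight_filter_mergeLast :
    edgeWeight (E.filter fun e => n + 1 ∉ e) (mergeLast n x) = edgeWeight E (mergeLast n x) := by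
  unfold edgeWeight
  rw [← Finset.sum_filter_add_sum_filter_not E (fun e => n + 1 ∉ e), left_eq_add]
  refine Finset.sum_eq_zero fun e he => ?_
  exact Finset.prod_eq_zero (i := n + 1) (by simpa using (Finset.mem_filter.1 he).2) mergeLast_succ

/-- Replacing the edges through the last vertex by as many missing triples. -/
theorem IsOptimal.isFeasible_union (h : IsOptimal (n + 1) m E x) (hn : 1 ≤ n)
    {T : Finset (Finset ℕ)} (hT : T ⊆ (Finset.Icc 1 n).powersetCard 3 \ E)
    (hTc : T.card = (E.filter fun e => n + 1 ∈ e).card) :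
    IsFeasible n m ((E.filter fun e => n + 1 ∉ e) ∪ T) (mergeLast n x) ∧
      edgeWeight ((E.filter fun e => n + 1 ∉ e) ∪ T) (mergeLast n x) =
        edgeWeight E (mergeLast n x) + edgeWeight T (mergeLast n x) := by
  have hdisj : Disjoint (E.filter fun e => n + 1 ∉ e) T :=
    Finset.disjoint_left.2 fun e he heT =>
      (Finset.mem_sdiff.1 (hT heT)).2 (Finset.mem_filter.1 he).1
  have hI : ∀ {i}, 1 ≤ i → i ≤ n + 1 → i ∈ Finset.Icc 1 (n + 1) := fun h1 h2 =>
    Finset.mem_Icc.2 ⟨h1, h2⟩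
  refine ⟨⟨?_, ?_, ?_, ?_⟩, ?_⟩
  · refine Finset.union_subset (fun e he => ?_) (hT.trans Finset.sdiff_subset)
    obtain ⟨he, hne⟩ := Finset.mem_filter.1 he
    obtain ⟨hs, hc⟩ := Finset.mem_powersetCard.1 (h.subset he)
    refine Finset.mem_powersetCard.2 ⟨fun k hk => ?_, hc⟩
    have h1 := Finset.mem_Icc.1 (hs hk)
    have h2 : k ≠ n + 1 := by rintro rfl; exact hne hk
    exact Finset.mem_Icc.2 ⟨h1.1, by omega⟩
  · rw [Finset.card_union_of_disjoint hdisj, hTc, ← h.card, add_comm]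
    exact Finset.card_filter_add_card_filter_not _
  · intro i hi
    rw [Finset.mem_Icc] at hi
    by_cases hin : i = n
    · subst hin
      rw [mergeLast_self]
      exact add_nonneg (h.nonneg _ (hI hn (by omega))) (h.nonneg _ (hI (by omega) le_rfl))
    · rw [mergeLast_of_ne hin (by omega)]
      exact h.nonneg _ (hI hi.1 (by omega))
  · have hs := h.sum_eq
    obtain ⟨k, rfl⟩ : ∃ k, n = k + 1 := ⟨n - 1, by omega⟩
    rw [Finset.sum_Icc_succ_top (by omega), Finset.sum_Icc_succ_top (by omega)] at hs
    rw [Finset.sum_Icc_succ_top (by omega), mergeLast_self]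
    have : ∑ i ∈ Finset.Icc 1 k, mergeLast (k + 1) x i = ∑ i ∈ Finset.Icc 1 k, x i := by
      refine Finset.sum_congr rfl fun i hi => ?_
      rw [Finset.mem_Icc] at hi
      exact mergeLast_of_ne (by omega) (by omega)
    linarith
  · rw [← edgeWeight_filter_mergeLast (E := E)]
    unfold edgeWeight
    exact Finset.sum_union hdisj

theorem IsOptimal.card_missing (h : IsOptimal (n + 1) m E x) (hm : m ≤ n.choose 3) :
    (E.filter fun e => n + 1 ∈ e).card ≤ ((Finset.Icc 1 n).powersetCard 3 \ E).card := by
  have h1 : (E.filter fun e => n + 1 ∈ e).card + (E.filter fun e => n + 1 ∉ e).card = m := by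
    rw [← h.card]
    exact Finset.card_filter_add_card_filter_not _
  have h2 : (Finset.Icc 1 n).powersetCard 3 ∩ E ⊆ E.filter fun e => n + 1 ∉ e := by
    intro e he
    obtain ⟨h2, h3⟩ := Finset.mem_inter.1 he
    refine Finset.mem_filter.2 ⟨h3, fun hne => ?_⟩
    have := Finset.mem_Icc.1 ((Finset.mem_powersetCard.1 h2).1 hne)
    omega
  have h3 := Finset.card_le_card h2
  have h4 := Finset.card_sdiff_add_card_inter ((Finset.Icc 1 n).powersetCard 3) E
  rw [Finset.card_powersetCard, Nat.card_Icc, Nat.add_sub_cancel] at h4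
  omega

theorem IsOptimal.exists_compensation (h : IsOptimal (n + 1) m E x) (hn : 5 ≤ n)
    (hm : m ≤ n.choose 3) : ∃ T ⊆ (Finset.Icc 1 n).powersetCard 3 \ E,
      T.card = (E.filter fun e => n + 1 ∈ e).card ∧
      pairLinkSum E x n (n + 1) * x (n + 1) ^ 2 ≤ edgeWeight T (mergeLast n x) := by
  have hI : ∀ {i}, 1 ≤ i → i ≤ n + 1 → i ∈ Finset.Icc 1 (n + 1) := fun h1 h2 =>
    Finset.mem_Icc.2 ⟨h1, h2⟩
  set M := (Finset.Icc 1 n).powersetCard 3 \ E with hM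
  set N := (E.filter fun e => n + 1 ∈ e).card with hN
  set y := mergeLast n x with hy
  have hv0 := h.nonneg _ (hI (by omega) le_rfl)
  have hxv : ∀ i, 1 ≤ i → i ≤ n + 1 → x (n + 1) ≤ x i := fun i h1 h2 =>
    h.antitone (hI h1 h2) (hI (by omega) le_rfl) h2
  have hxu : ∀ i, 1 ≤ i → i ≤ n → x n ≤ x i := fun i h1 h2 =>
    h.antitone (hI h1 (by omega)) (hI (by omega) (by omega)) h2
  have huv := hxv n (by omega) (by omega)
  have hu0 := hv0.trans huv
  have hyu : ∀ i ∈ Finset.Icc 1 n, x n ≤ y i := by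
    intro i hi
    rw [Finset.mem_Icc] at hi
    by_cases hin : i = n
    · rw [hin, hy, mergeLast_self]; linarith
    · rw [hy, mergeLast_of_ne hin (by omega)]; exact hxu i hi.1 hi.2
  have hMw : ∀ e ∈ M, x n ^ 3 ≤ ∏ i ∈ e, y i := by
    intro e he
    obtain ⟨hs, hc⟩ := Finset.mem_powersetCard.1 (Finset.mem_sdiff.1 he).1
    rw [← hc, ← Finset.prod_const]
    exact Finset.prod_le_prod (fun _ _ => hu0) fun i hi => hyu i (hs hi)
  have hNM : N ≤ M.card := h.card_missing hm
  set B := (Finset.Icc 1 (n - 1)).filter fun p => ({p, n, n + 1} : Finset ℕ) ∈ E with hB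
  have hc : pairLinkSum E x n (n + 1) = ∑ p ∈ B, x p := by
    rw [pairLinkSum_eq h.subset x (by omega)]
    refine Finset.sum_congr ?_ fun _ _ => rfl
    ext p
    simp only [hB, Finset.mem_filter, Finset.mem_Icc]
    constructor
    · rintro ⟨h1, h2, h3, h4⟩
      exact ⟨by omega, h4⟩
    · rintro ⟨h1, h2⟩
      exact ⟨by omega, by omega, by omega, h2⟩
  have htriv : pairLinkSum E x n (n + 1) * x (n + 1) ^ 2 = 0 → ∃ T ⊆ M, T.card = N ∧
      pairLinkSum E x n (n + 1) * x (n + 1) ^ 2 ≤ edgeWeight T y := by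
    intro h0
    obtain ⟨T, hTM, hTc⟩ := Finset.exists_subset_card_eq hNM
    refine ⟨T, hTM, hTc, ?_⟩
    rw [h0]
    exact Finset.sum_nonneg fun e he => (pow_nonneg hu0 3).trans (hMw e (hTM he))
  rcases hv0.eq_or_lt with hv | hv
  · exact htriv (by rw [← hv]; ring)
  rcases B.eq_empty_or_nonempty with hBe | ⟨p₀, hp₀⟩
  · exact htriv (by rw [hc, hBe]; simp)
  obtain ⟨hp₀, hp₀E⟩ := Finset.mem_filter.1 hp₀
  rw [Finset.mem_Icc] at hp₀
  have h1E := h.one_mem_of_mem_pair hp₀.1 (by omega) hp₀E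
  set S := Finset.Icc 2 (n - 1) with hS
  have hnS : n ∉ S := by simp only [hS, Finset.mem_Icc]; omega
  have hScard : S.card = n - 2 := by rw [hS, Nat.card_Icc]; omega
  set P := (S.powersetCard 2).filter fun a => insert n a ∉ E with hP
  have hPS : ∀ a ∈ P, a ⊆ S ∧ a.card = 2 := fun a ha =>
    Finset.mem_powersetCard.1 (Finset.mem_filter.1 ha).1
  set D := ∑ a ∈ P, ∏ k ∈ a, x k with hD
  have hbound : (x 1 - x n - x (n + 1)) * (∑ p ∈ S, x p + x (n + 1)) ≤ D :=
    h.first_weight_bound (by omega) h1E hv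
  have hins : ∀ a ∈ P, insert n a ∈ M := by
    intro a ha
    obtain ⟨hs, hc⟩ := hPS a ha
    refine Finset.mem_sdiff.2 ⟨Finset.mem_powersetCard.2 ⟨?_, ?_⟩, (Finset.mem_filter.1 ha).2⟩
    · refine Finset.insert_subset (Finset.mem_Icc.2 ⟨by omega, le_rfl⟩) (hs.trans ?_)
      exact Finset.Icc_subset_Icc (by omega) (by omega)
    · rw [Finset.card_insert_of_notMem fun h => hnS (hs h), hc]
  have hinj : Set.InjOn (insert n) (P : Set (Finset ℕ)) := by
    intro a ha b hb hab
    have ha' : n ∉ a := fun h => hnS ((hPS a ha).1 h)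
    have hb' : n ∉ b := fun h => hnS ((hPS b hb).1 h)
    rw [← Finset.erase_insert ha', ← Finset.erase_insert hb']
    exact congrArg (fun s => Finset.erase s n) hab
  have hwt : ∀ Q ⊆ P, edgeWeight (Q.image (insert n)) y =
      (x n + x (n + 1)) * ∑ a ∈ Q, ∏ k ∈ a, x k := by
    intro Q hQ
    unfold edgeWeight
    rw [Finset.sum_image (hinj.mono (by exact_mod_cast hQ)), Finset.mul_sum]
    refine Finset.sum_congr rfl fun a ha => ?_
    have hs := (hPS a (hQ ha)).1
    rw [Finset.prod_insert fun h => hnS (hs h), hy, mergeLast_self]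
    congr 1
    refine Finset.prod_congr rfl fun k hk => ?_
    have := Finset.mem_Icc.1 (hs hk)
    exact mergeLast_of_ne (by omega) (by omega)
  have hPu : ∀ a ∈ P, x n ^ 2 ≤ ∏ k ∈ a, x k := by
    intro a ha
    obtain ⟨hs, hc⟩ := hPS a ha
    rw [← hc, ← Finset.prod_const]
    refine Finset.prod_le_prod (fun _ _ => hu0) fun i hi => ?_
    have := Finset.mem_Icc.1 (hs hi)
    exact hxu i (by omega) (by omega)
  have hQu : ∀ Q ⊆ P, (Q.card : ℝ) * x n ^ 2 ≤ ∑ a ∈ Q, ∏ k ∈ a, x k := by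
    intro Q hQ
    rw [← nsmul_eq_mul]
    exact Finset.card_nsmul_le_sum _ _ _ fun a ha => hPu a (hQ ha)
  have hcB : pairLinkSum E x n (n + 1) ≤ B.card * x 1 := by
    rw [hc, ← nsmul_eq_mul]
    refine Finset.sum_le_card_nsmul _ _ _ fun p hp => ?_
    have := Finset.mem_Icc.1 (Finset.mem_filter.1 hp).1
    exact h.antitone (hI le_rfl (by omega)) (hI this.1 (by omega)) this.1
  have hBcard : B.card ≤ n - 1 := by
    refine (Finset.card_filter_le _ _).trans ?_
    simp
  have hBN : B.card * (n - 1) ≤ N * 2 := h.card_mul_le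
  have hc₁ : ((n - 1 : ℕ) : ℝ) * x (n + 1) ≤ ∑ p ∈ S, x p + x (n + 1) := by
    have : S.card • x (n + 1) ≤ ∑ p ∈ S, x p := by
      refine Finset.card_nsmul_le_sum _ _ _ fun p hp => ?_
      have := Finset.mem_Icc.1 hp
      exact hxv p (by omega) (by omega)
    rw [hScard, nsmul_eq_mul] at this
    rw [show n - 1 = n - 2 + 1 by omega]
    push_cast
    linarith
  have hD0 : 0 ≤ D := Finset.sum_nonneg fun a ha => (pow_nonneg hu0 2).trans (hPu a ha)
  have hN2 : 2 * (B.card : ℝ) ≤ N := by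
    have : 2 * B.card ≤ N := by
      have : B.card * 4 ≤ B.card * (n - 1) := Nat.mul_le_mul_left _ (by omega)
      omega
    exact_mod_cast this
  have hq : (0 : ℝ) < (n - 1 : ℕ) := by exact_mod_cast (by omega : 0 < n - 1)
  have hloss := mul_le_mul_of_nonneg_right hcB (sq_nonneg (x (n + 1)))
  rcases le_total P.card N with hPN | hPN
  · have himg : P.image (insert n) ⊆ M := fun e he => by
      obtain ⟨a, ha, rfl⟩ := Finset.mem_image.1 he
      exact hins a ha
    have himgc : (P.image (insert n)).card = P.card := Finset.card_image_of_injOn hinj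
    obtain ⟨T, hPT, hTM, hTc⟩ := Finset.exists_subsuperset_card_eq himg (himgc.trans_le hPN) hNM
    refine ⟨T, hTM, hTc, hloss.trans ?_⟩
    refine (loss_le_of_few (N := N) (K := P.card) hv huv (Nat.cast_nonneg _) hq hD0 hc₁ hbound
      (hQu P subset_rfl) hN2 (by exact_mod_cast hBcard)).trans ?_
    have h1 : edgeWeight T y = edgeWeight (T \ P.image (insert n)) y +
        edgeWeight (P.image (insert n)) y := (Finset.sum_sdiff hPT).symm
    have h2 : ((N : ℝ) - P.card) * x n ^ 3 ≤ edgeWeight (T \ P.image (insert n)) y := by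
      have h3 : (N : ℝ) - P.card = ((T \ P.image (insert n)).card : ℝ) := by
        rw [Finset.card_sdiff_of_subset hPT, hTc, himgc, Nat.cast_sub hPN]
      rw [h3, ← nsmul_eq_mul]
      exact Finset.card_nsmul_le_sum _ _ _ fun e he => hMw e (hTM (Finset.mem_sdiff.1 he).1)
    rw [h1, hwt P subset_rfl]
    linarith
  · obtain ⟨Q, hQP, hQc, hQ⟩ := exists_subset_card_mul_sum_le P (fun a => ∏ k ∈ a, x k) hPN
    refine ⟨Q.image (insert n), fun e he => ?_, ?_, hloss.trans ?_⟩
    · obtain ⟨a, ha, rfl⟩ := Finset.mem_image.1 he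
      exact hins a (hQP ha)
    · rw [Finset.card_image_of_injOn (hinj.mono (by exact_mod_cast hQP)), hQc]
    rw [hwt Q hQP]
    have hB0 : 0 < B.card := Finset.card_pos.2 ⟨p₀, by
      rw [hB, Finset.mem_filter, Finset.mem_Icc]; exact ⟨hp₀, hp₀E⟩⟩
    have hN0 : 0 < N := by
      have : 0 < B.card * (n - 1) := Nat.mul_pos hB0 (by omega)
      omega
    refine loss_le_of_many (N := N) (K := P.card) hv huv (Nat.cast_nonneg _) hq hD0 hc₁ hbound
      (by exact_mod_cast hN0.trans_le hPN) (hQc ▸ hQu Q hQP) hQ hN2 ?_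
    have hK : P.card * 2 ≤ (n - 1) * (n - 1) := by
      have h1 : P.card ≤ (n - 2).choose 2 := by
        rw [← hScard, ← Finset.card_powersetCard]
        exact Finset.card_filter_le _ _
      rw [Nat.choose_two_right] at h1
      have h2 := Nat.div_mul_le_self ((n - 2) * (n - 2 - 1)) 2
      have h3 : (n - 2) * (n - 2 - 1) ≤ (n - 1) * (n - 1) :=
        Nat.mul_le_mul (by omega) (by omega)
      omega
    have : B.card * P.card ≤ N * (n - 1) := by
      have h1 := Nat.mul_le_mul_left B.card hK
      have h2 := Nat.mul_le_mul_right (n - 1) hBN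
      nlinarith
    exact_mod_cast this

theorem IsOptimal.exists_isFeasible_pred (h : IsOptimal (n + 1) m E x) (hn : 5 ≤ n)
    (hm : m ≤ n.choose 3) :
    ∃ E' x', IsFeasible n m E' x' ∧ edgeWeight E x ≤ edgeWeight E' x' := by
  obtain ⟨T, hT, hTc, hle⟩ := h.exists_compensation hn hm
  obtain ⟨hf, hw⟩ := h.isFeasible_union (by omega) hT hTc
  have := h.edgeWeight_le_mergeLast (by omega)
  exact ⟨_, _, hf, by linarith⟩

end Descent

theorem card_triple {p q r : ℕ} (hpq : p < q) (hqr : q < r) : ({p, q, r} : Finset ℕ).card = 3 :=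
  Finset.card_eq_three.2 ⟨p, q, r, hpq.ne, (hpq.trans hqr).ne, hqr.ne, rfl⟩

theorem triple_inj {p q r p' q' r' : ℕ} (hpq : p < q) (hqr : q < r) (hpq' : p' < q')
    (hqr' : q' < r') :
    ({p, q, r} : Finset ℕ) = {p', q', r'} ↔ p = p' ∧ q = q' ∧ r = r' := by
  constructor
  · intro h
    have h1 : ∀ k, k ∈ ({p, q, r} : Finset ℕ) ↔ k ∈ ({p', q', r'} : Finset ℕ) := fun k => by rw [h]
    simp only [Finset.mem_insert, Finset.mem_singleton] at h1
    have := (h1 p).1 (by simp)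
    have := (h1 q).1 (by simp)
    have := (h1 r).1 (by simp)
    have := (h1 p').2 (by simp)
    omega
  · rintro ⟨rfl, rfl, rfl⟩
    rfl

theorem exists_sorted_triple {e : Finset ℕ} (he : e.card = 3) :
    ∃ p q r, p < q ∧ q < r ∧ e = {p, q, r} := by
  have hmono := (e.orderEmbOfFin he).strictMono
  refine ⟨e.orderEmbOfFin he 0, e.orderEmbOfFin he 1, e.orderEmbOfFin he 2, hmono (by decide),
    hmono (by decide), ?_⟩
  symm
  refine Finset.eq_of_subset_of_card_le ?_ ?_
  · intro k hk
    simp only [Finset.mem_insert, Finset.mem_singleton] at hk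
    rcases hk with rfl | rfl | rfl <;> exact Finset.orderEmbOfFin_mem _ _ _
  · rw [he, card_triple (hmono (by decide)) (hmono (by decide))]

/-- The last three triples of `[n + 5]` in the colex ordering. -/
def colexTail (n : ℕ) : Finset (Finset ℕ) :=
  {{n + 3, n + 4, n + 5}, {n + 2, n + 4, n + 5}, {n + 1, n + 4, n + 5}}

/-- The three triples on the last four vertices of `[n + 5]` that contain the last one. -/
def lastStar (n : ℕ) : Finset (Finset ℕ) :=
  {{n + 3, n + 4, n + 5}, {n + 2, n + 4, n + 5}, {n + 2, n + 3, n + 5}}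

theorem card_colexTail (n : ℕ) : (colexTail n).card = 3 := by
  refine Finset.card_eq_three.2 ⟨_, _, _, ?_, ?_, ?_, rfl⟩ <;>
  · rw [Ne, triple_inj] <;> omega

theorem card_lastStar (n : ℕ) : (lastStar n).card = 3 := by
  refine Finset.card_eq_three.2 ⟨_, _, _, ?_, ?_, ?_, rfl⟩ <;>
  · rw [Ne, triple_inj] <;> omega

theorem mem_colexTail {n : ℕ} {A : Finset ℕ} :
    A ∈ colexTail n ↔ ∃ i, n + 1 ≤ i ∧ i ≤ n + 3 ∧ A = {i, n + 4, n + 5} := by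
  simp only [colexTail, Finset.mem_insert, Finset.mem_singleton]
  constructor
  · rintro (h | h | h)
    exacts [⟨n + 3, by omega, by omega, h⟩, ⟨n + 2, by omega, by omega, h⟩,
      ⟨n + 1, by omega, by omega, h⟩]
  · rintro ⟨i, h1, h2, h⟩
    obtain rfl | rfl | rfl : i = n + 1 ∨ i = n + 2 ∨ i = n + 3 := by omega
    exacts [Or.inr (Or.inr h), Or.inr (Or.inl h), Or.inl h]

theorem triple_mem_powersetCard {n p q r : ℕ} (hp : 1 ≤ p) (hpq : p < q) (hqr : q < r)
    (hr : r ≤ n) : ({p, q, r} : Finset ℕ) ∈ (Finset.Icc 1 n).powersetCard 3 := by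
  refine Finset.mem_powersetCard.2 ⟨fun k hk => ?_, card_triple hpq hqr⟩
  simp only [Finset.mem_insert, Finset.mem_singleton] at hk
  rw [Finset.mem_Icc]
  omega

theorem colexTail_subset (n : ℕ) : colexTail n ⊆ (Finset.Icc 1 (n + 5)).powersetCard 3 := by
  intro A hA
  obtain ⟨i, h1, h2, rfl⟩ := mem_colexTail.1 hA
  exact triple_mem_powersetCard (by omega) (by omega) (by omega) (by omega)

theorem lastStar_subset (n : ℕ) : lastStar n ⊆ (Finset.Icc 1 (n + 5)).powersetCard 3 := by
  intro A hA
  simp only [lastStar, Finset.mem_insert, Finset.mem_singleton] at hA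
  rcases hA with rfl | rfl | rfl <;>
    exact triple_mem_powersetCard (by omega) (by omega) (by omega) (by omega)

theorem mem_colexTail_of_le {n : ℕ} {A B : Finset ℕ}
    (hA : A ∈ (Finset.Icc 1 (n + 5)).powersetCard 3) (hB : B ∈ colexTail n)
    (hBA : toColex B ≤ toColex A) : A ∈ colexTail n := by
  obtain ⟨i, hi1, hi3, rfl⟩ := mem_colexTail.1 hB
  obtain ⟨hAs, hAc⟩ := Finset.mem_powersetCard.1 hA
  rw [Finset.Colex.toColex_le_toColex] at hBA
  have hle : ∀ b ∈ A, b ≤ n + 5 := fun b hb => (Finset.mem_Icc.1 (hAs hb)).2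
  have h5 : n + 5 ∈ A := by
    by_contra h
    obtain ⟨b, hb, hbB, hib⟩ := hBA (a := n + 5) (by simp) h
    have := hle b hb
    simp only [Finset.mem_insert, Finset.mem_singleton] at hbB
    omega
  have h4 : n + 4 ∈ A := by
    by_contra h
    obtain ⟨b, hb, hbB, hib⟩ := hBA (a := n + 4) (by simp) h
    have := hle b hb
    simp only [Finset.mem_insert, Finset.mem_singleton] at hbB
    omega
  obtain ⟨b, hb, hib, hb3⟩ : ∃ b ∈ A, i ≤ b ∧ b ≤ n + 3 := by
    by_cases h : i ∈ A
    · exact ⟨i, h, le_rfl, hi3⟩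
    obtain ⟨b, hb, hbB, hib⟩ := hBA (a := i) (by simp) h
    have := hle b hb
    simp only [Finset.mem_insert, Finset.mem_singleton] at hbB
    exact ⟨b, hb, hib, by omega⟩
  refine mem_colexTail.2 ⟨b, by omega, hb3, ?_⟩
  symm
  refine Finset.eq_of_subset_of_card_le ?_ ?_
  · intro k hk
    simp only [Finset.mem_insert, Finset.mem_singleton] at hk
    rcases hk with rfl | rfl | rfl <;> assumption
  · rw [hAc, card_triple (by omega) (by omega)]

theorem le_choose_three (n : ℕ) : n + 5 ≤ (n + 5).choose 3 := by
  induction n with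
  | zero => decide
  | succ n ih =>
    have h1 : (n + 1 + 5).choose 3 = (n + 5).choose 2 + (n + 5).choose 3 := Nat.choose_succ_succ _ _
    have h2 : 0 < (n + 5).choose 2 := Nat.choose_pos (by omega)
    omega

theorem card_powersetCard_sdiff {n : ℕ} {M : Finset (Finset ℕ)}
    (hM : M ⊆ (Finset.Icc 1 n).powersetCard 3) :
    ((Finset.Icc 1 n).powersetCard 3 \ M).card = n.choose 3 - M.card := by
  rw [Finset.card_sdiff_of_subset hM, Finset.card_powersetCard, Nat.card_Icc, Nat.add_sub_cancel]

theorem colexFirst_eq {n m : ℕ} (hm : m + 3 = (n + 5).choose 3) :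
    colexFirst 3 m = (Finset.Icc 1 (n + 5)).powersetCard 3 \ colexTail n := by
  symm
  have hcard : ((Finset.Icc 1 (n + 5)).powersetCard 3 \ colexTail n).card = m := by
    rw [card_powersetCard_sdiff (colexTail_subset n), card_colexTail]
    omega
  have hn := le_choose_three n
  refine Finset.eq_of_subset_of_card_le ?_ (by rw [card_colexFirst 3 m (by omega), hcard])
  intro A hA
  obtain ⟨hA1, hA2⟩ := Finset.mem_sdiff.1 hA
  obtain ⟨hAs, hAc⟩ := Finset.mem_powersetCard.1 hA1
  refine Finset.mem_filter.2 ⟨Finset.mem_powersetCard.2 ⟨hAs.trans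
    (Finset.Icc_subset_Icc le_rfl (by omega)), hAc⟩, ?_⟩
  conv_rhs => rw [← hcard]
  refine Finset.card_lt_card ⟨?_, fun h => ?_⟩
  · intro B hB
    obtain ⟨hB1, hB2⟩ := Finset.mem_filter.1 hB
    obtain ⟨hBs, hBc⟩ := Finset.mem_powersetCard.1 hB1
    refine Finset.mem_sdiff.2 ⟨Finset.mem_powersetCard.2 ⟨fun b hb => ?_, hBc⟩, fun hBt =>
      hA2 (mem_colexTail_of_le hA1 hBt hB2.le)⟩
    exact Finset.mem_Icc.2 ⟨(Finset.mem_Icc.1 (hBs hb)).1, Finset.Colex.forall_le_mono hB2.le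
      (fun a ha => (Finset.mem_Icc.1 (hAs ha)).2) b hb⟩
  · have := h hA
    simp at this

theorem edgeWeight_le_lagrangian_colexGraph {n m : ℕ} (hm : m + 3 = (n + 5).choose 3) {y : ℕ → ℝ}
    (hy : ∀ i ∈ Finset.Icc 1 (n + 5), 0 ≤ y i) (hsum : ∑ i ∈ Finset.Icc 1 (n + 5), y i = 1) :
    edgeWeight ((Finset.Icc 1 (n + 5)).powersetCard 3 \ colexTail n) y ≤
      (colexGraph 3 m).lagrangian := by
  have hE : (colexGraph 3 m).edges = (Finset.Icc 1 (n + 5)).powersetCard 3 \ colexTail n :=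
    colexFirst_eq hm
  have hmem : ∀ p q r, 1 ≤ p → p < q → q < r → r ≤ n + 5 → q ≤ n + 3 →
      ({p, q, r} : Finset ℕ) ∈ colexFirst 3 m := by
    intro p q r hp hpq hqr hr hq
    rw [colexFirst_eq hm]
    refine Finset.mem_sdiff.2 ⟨triple_mem_powersetCard hp hpq hqr hr, fun h => ?_⟩
    obtain ⟨i, h1, h2, h3⟩ := mem_colexTail.1 h
    rw [triple_inj hpq hqr (by omega) (by omega)] at h3
    omega
  have hV : (colexGraph 3 m).verts = Finset.Icc 1 (n + 5) := by
    refine Finset.Subset.antisymm ?_ fun i hi => ?_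
    · refine Finset.biUnion_subset.2 fun e he => ?_
      rw [colexFirst_eq hm] at he
      exact (Finset.mem_powersetCard.1 (Finset.mem_sdiff.1 he).1).1
    · rw [Finset.mem_Icc] at hi
      refine Finset.mem_biUnion.2 ?_
      by_cases h3 : i ≤ 3
      · refine ⟨{1, 2, 3}, hmem 1 2 3 le_rfl (by omega) (by omega) (by omega) (by omega), ?_⟩
        simp only [id, Finset.mem_insert, Finset.mem_singleton]
        omega
      · exact ⟨{1, 2, i}, hmem 1 2 i le_rfl (by omega) (by omega) (by omega) (by omega), by simp⟩
  have hne : (colexGraph 3 m).verts.Nonempty := by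
    rw [hV]
    exact Finset.nonempty_Icc.2 (by omega)
  refine ((colexGraph 3 m).isGreatest_lagrangian hne).2 ⟨y, ⟨?_, ?_⟩, ?_⟩
  · rwa [hV]
  · rwa [hV]
  · unfold RGraph.weight edgeWeight
    rw [hE]

theorem eq_colexTail_or_eq_lastStar {n : ℕ} {M : Finset (Finset ℕ)}
    (hM : M ⊆ (Finset.Icc 1 (n + 5)).powersetCard 3) (hc : M.card = 3)
    (hup : ∀ p q r p' q' r', p < q → q < r → ({p, q, r} : Finset ℕ) ∈ M → p ≤ p' → q ≤ q' →
      r ≤ r' → p' < q' → q' < r' → r' ≤ n + 5 → ({p', q', r'} : Finset ℕ) ∈ M) :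
    M = colexTail n ∨ M = lastStar n := by
  have hfour : ∀ a b c d, a ∈ M → b ∈ M → c ∈ M → d ∈ M → a ≠ b → a ≠ c → a ≠ d → b ≠ c →
      b ≠ d → c ≠ d → False := by
    intro a b c d ha hb hc' hd h1 h2 h3 h4 h5 h6
    have h7 : ({a, b, c, d} : Finset (Finset ℕ)).card = 4 := by
      rw [Finset.card_insert_of_notMem, Finset.card_eq_three.2 ⟨b, c, d, h4, h5, h6, rfl⟩]
      simp [h1, h2, h3]
    have h8 : ({a, b, c, d} : Finset (Finset ℕ)) ⊆ M := by
      intro e he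
      simp only [Finset.mem_insert, Finset.mem_singleton] at he
      rcases he with rfl | rfl | rfl | rfl <;> assumption
    have := Finset.card_le_card h8
    omega
  have hcases : ∀ e ∈ M, e ∈ colexTail n ∨ e = {n + 2, n + 3, n + 5} := by
    intro e he
    obtain ⟨hes, hec⟩ := Finset.mem_powersetCard.1 (hM he)
    obtain ⟨p, q, r, hpq, hqr, rfl⟩ := exists_sorted_triple hec
    have hr : r ≤ n + 5 := (Finset.mem_Icc.1 (hes (by simp))).2
    have hu := fun p' q' r' => hup p q r p' q' r' hpq hqr he
    rcases hr.lt_or_eq with hr | rfl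
    · exfalso
      refine hfour {n + 2, n + 3, n + 4} {n + 2, n + 3, n + 5} {n + 2, n + 4, n + 5}
        {n + 3, n + 4, n + 5} (hu _ _ _ ?_ ?_ ?_ ?_ ?_ ?_) (hu _ _ _ ?_ ?_ ?_ ?_ ?_ ?_)
        (hu _ _ _ ?_ ?_ ?_ ?_ ?_ ?_) (hu _ _ _ ?_ ?_ ?_ ?_ ?_ ?_) ?_ ?_ ?_ ?_ ?_ ?_
      all_goals first | omega | (rw [Ne, triple_inj] <;> omega)
    · rcases (show q ≤ n + 4 by omega).eq_or_lt with rfl | hq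
      · by_cases hp : n + 1 ≤ p
        · exact Or.inl (mem_colexTail.2 ⟨p, hp, by omega, rfl⟩)
        exfalso
        refine hfour {p, n + 4, n + 5} {n + 1, n + 4, n + 5} {n + 2, n + 4, n + 5}
          {n + 3, n + 4, n + 5} he (hu _ _ _ ?_ ?_ ?_ ?_ ?_ ?_)
          (hu _ _ _ ?_ ?_ ?_ ?_ ?_ ?_) (hu _ _ _ ?_ ?_ ?_ ?_ ?_ ?_) ?_ ?_ ?_ ?_ ?_ ?_
        all_goals first | omega | (rw [Ne, triple_inj] <;> omega)
      · by_cases hp : n + 2 ≤ p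
        · right
          rw [triple_inj] <;> omega
        exfalso
        refine hfour {n + 1, n + 3, n + 5} {n + 2, n + 3, n + 5} {n + 1, n + 4, n + 5}
          {n + 2, n + 4, n + 5} (hu _ _ _ ?_ ?_ ?_ ?_ ?_ ?_) (hu _ _ _ ?_ ?_ ?_ ?_ ?_ ?_)
          (hu _ _ _ ?_ ?_ ?_ ?_ ?_ ?_) (hu _ _ _ ?_ ?_ ?_ ?_ ?_ ?_) ?_ ?_ ?_ ?_ ?_ ?_
        all_goals first | omega | (rw [Ne, triple_inj] <;> omega)
  by_cases h1 : ({n + 1, n + 4, n + 5} : Finset ℕ) ∈ M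
  · left
    refine Finset.eq_of_subset_of_card_le (fun e he => (hcases e he).resolve_right ?_)
      (by rw [hc, card_colexTail])
    rintro rfl
    have hu := fun p' q' r' => hup (n + 1) (n + 4) (n + 5) p' q' r' (by omega) (by omega) h1
    refine hfour {n + 1, n + 4, n + 5} {n + 2, n + 3, n + 5} {n + 2, n + 4, n + 5}
      {n + 3, n + 4, n + 5} h1 he (hu _ _ _ ?_ ?_ ?_ ?_ ?_ ?_) (hu _ _ _ ?_ ?_ ?_ ?_ ?_ ?_)
      ?_ ?_ ?_ ?_ ?_ ?_
    all_goals first | omega | (rw [Ne, triple_inj] <;> omega)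
  · right
    refine Finset.eq_of_subset_of_card_le (fun e he => ?_) (by rw [hc, card_lastStar])
    simp only [lastStar, Finset.mem_insert, Finset.mem_singleton]
    rcases hcases e he with h | h
    · simp only [colexTail, Finset.mem_insert, Finset.mem_singleton] at h
      rcases h with h | h | rfl
      exacts [Or.inl h, Or.inr (Or.inl h), absurd he h1]
    · exact Or.inr (Or.inr h)

theorem edgeWeight_powersetCard_Icc (x : ℕ → ℝ) (n k : ℕ) :
    edgeWeight ((Finset.Icc 1 (n + 1)).powersetCard (k + 1)) x =
      edgeWeight ((Finset.Icc 1 n).powersetCard (k + 1)) x +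
        x (n + 1) * edgeWeight ((Finset.Icc 1 n).powersetCard k) x := by
  have hn : n + 1 ∉ Finset.Icc 1 n := by simp
  have hset : Finset.Icc 1 (n + 1) = insert (n + 1) (Finset.Icc 1 n) := by
    ext i
    simp only [Finset.mem_insert, Finset.mem_Icc]
    omega
  have hmem : ∀ {j : ℕ}, ∀ a ∈ (Finset.Icc 1 n).powersetCard j, n + 1 ∉ a := fun a ha h =>
    hn ((Finset.mem_powersetCard.1 ha).1 h)
  unfold edgeWeight
  rw [hset, Finset.powersetCard_succ_insert hn, Finset.sum_union, Finset.sum_image,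
    Finset.mul_sum]
  · congr 1
    exact Finset.sum_congr rfl fun a ha => Finset.prod_insert (hmem a ha)
  · intro a ha b hb hab
    rw [← Finset.erase_insert (hmem a ha), ← Finset.erase_insert (hmem b hb)]
    exact congrArg (fun s => Finset.erase s (n + 1)) hab
  · refine Finset.disjoint_left.2 fun a ha hb => ?_
    obtain ⟨b, -, rfl⟩ := Finset.mem_image.1 hb
    exact hmem _ ha (Finset.mem_insert_self _ _)

theorem sum_Icc_add_five (x : ℕ → ℝ) (n : ℕ) : ∑ i ∈ Finset.Icc 1 (n + 5), x i =
    ∑ i ∈ Finset.Icc 1 n, x i +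
      (x (n + 1) + x (n + 2) + x (n + 3) + x (n + 4) + x (n + 5)) := by
  rw [show n + 5 = n + 4 + 1 by rfl, Finset.sum_Icc_succ_top (by omega),
    show n + 4 = n + 3 + 1 by rfl, Finset.sum_Icc_succ_top (by omega),
    show n + 3 = n + 2 + 1 by rfl, Finset.sum_Icc_succ_top (by omega),
    show n + 2 = n + 1 + 1 by rfl, Finset.sum_Icc_succ_top (by omega),
    Finset.sum_Icc_succ_top (by omega)]
  ring

theorem edgeWeight_powersetCard_three (x : ℕ → ℝ) (n : ℕ) :
    edgeWeight ((Finset.Icc 1 (n + 5)).powersetCard 3) x =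
      edgeWeight ((Finset.Icc 1 n).powersetCard 3) x +
        edgeWeight ((Finset.Icc 1 n).powersetCard 2) x *
          (x (n + 1) + x (n + 2) + x (n + 3) + x (n + 4) + x (n + 5)) +
        fivePoly (∑ i ∈ Finset.Icc 1 n, x i)
          (x (n + 1)) (x (n + 2)) (x (n + 3)) (x (n + 4)) (x (n + 5)) := by
  have h0 : ∀ k, edgeWeight ((Finset.Icc 1 k).powersetCard 0) x = 1 := by
    intro k
    simp [edgeWeight]
  have h1 : edgeWeight ((Finset.Icc 1 n).powersetCard 1) x = ∑ i ∈ Finset.Icc 1 n, x i := by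
    unfold edgeWeight
    rw [Finset.powersetCard_one, Finset.sum_map]
    simp
  have e1 := edgeWeight_powersetCard_Icc x n
  have e2 := edgeWeight_powersetCard_Icc x (n + 1)
  have e3 := edgeWeight_powersetCard_Icc x (n + 2)
  have e4 := edgeWeight_powersetCard_Icc x (n + 3)
  have e5 := edgeWeight_powersetCard_Icc x (n + 4)
  rw [e5 2, e4 2, e3 2, e2 2, e1 2, e4 1, e3 1, e2 1, e1 1, e3 0, e2 0, e1 0]
  simp only [h0, h1, Nat.reduceAdd]
  unfold fivePoly
  ring

theorem prod_triple (x : ℕ → ℝ) {p q r : ℕ} (hpq : p < q) (hqr : q < r) :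
    ∏ i ∈ ({p, q, r} : Finset ℕ), x i = x p * x q * x r := by
  rw [Finset.prod_insert (by simp; omega), Finset.prod_pair hqr.ne, mul_assoc]

theorem edgeWeight_sdiff {P M : Finset (Finset ℕ)} (h : M ⊆ P) (x : ℕ → ℝ) :
    edgeWeight (P \ M) x = edgeWeight P x - edgeWeight M x :=
  eq_sub_of_add_eq (Finset.sum_sdiff h)

theorem edgeWeight_three {a b c : Finset ℕ} (hab : a ≠ b) (hac : a ≠ c) (hbc : b ≠ c)
    (x : ℕ → ℝ) : edgeWeight {a, b, c} x = ∏ i ∈ a, x i + ∏ i ∈ b, x i + ∏ i ∈ c, x i := by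
  unfold edgeWeight
  rw [Finset.sum_insert (by simp [hab, hac]), Finset.sum_pair hbc, add_assoc]

theorem edgeWeight_colexTail (x : ℕ → ℝ) (n : ℕ) : edgeWeight (colexTail n) x =
    (x (n + 1) + x (n + 2) + x (n + 3)) * x (n + 4) * x (n + 5) := by
  rw [colexTail, edgeWeight_three, prod_triple x (by omega) (by omega),
    prod_triple x (by omega) (by omega), prod_triple x (by omega) (by omega)]
  · ring
  all_goals rw [Ne, triple_inj] <;> omega

theorem edgeWeight_lastStar (x : ℕ → ℝ) (n : ℕ) : edgeWeight (lastStar n) x =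
    x (n + 2) * x (n + 3) * x (n + 5) + x (n + 2) * x (n + 4) * x (n + 5) +
      x (n + 3) * x (n + 4) * x (n + 5) := by
  rw [lastStar, edgeWeight_three, prod_triple x (by omega) (by omega),
    prod_triple x (by omega) (by omega), prod_triple x (by omega) (by omega)]
  · ring
  all_goals rw [Ne, triple_inj] <;> omega

/-- The weighting `x` with the weights of `n + 1, …, n + 5` replaced. -/
def replaceFive (n : ℕ) (x : ℕ → ℝ) (e a b c d : ℝ) : ℕ → ℝ := fun k =>
  if k = n + 1 then e else if k = n + 2 then a else if k = n + 3 then b else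
    if k = n + 4 then c else if k = n + 5 then d else x k

section ReplaceFive

variable {n : ℕ} {x : ℕ → ℝ} {e a b c d : ℝ}

theorem replaceFive_of_le {k : ℕ} (hk : k ≤ n) : replaceFive n x e a b c d k = x k := by
  simp only [replaceFive]
  rw [if_neg, if_neg, if_neg, if_neg, if_neg] <;> omega

theorem replaceFive_vals : replaceFive n x e a b c d (n + 1) = e ∧
    replaceFive n x e a b c d (n + 2) = a ∧ replaceFive n x e a b c d (n + 3) = b ∧
    replaceFive n x e a b c d (n + 4) = c ∧ replaceFive n x e a b c d (n + 5) = d := by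
  simp [replaceFive]

theorem edgeWeight_replaceFive (k : ℕ) :
    edgeWeight ((Finset.Icc 1 n).powersetCard k) (replaceFive n x e a b c d) =
      edgeWeight ((Finset.Icc 1 n).powersetCard k) x := by
  refine Finset.sum_congr rfl fun s hs => Finset.prod_congr rfl fun i hi => ?_
  exact replaceFive_of_le (Finset.mem_Icc.1 ((Finset.mem_powersetCard.1 hs).1 hi)).2

theorem sum_replaceFive :
    ∑ i ∈ Finset.Icc 1 n, replaceFive n x e a b c d i = ∑ i ∈ Finset.Icc 1 n, x i :=
  Finset.sum_congr rfl fun _ hi => replaceFive_of_le (Finset.mem_Icc.1 hi).2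

theorem replaceFive_nonneg (h : ∀ i ∈ Finset.Icc 1 (n + 5), 0 ≤ x i) (he : 0 ≤ e) (ha : 0 ≤ a)
    (hb : 0 ≤ b) (hc : 0 ≤ c) (hd : 0 ≤ d) :
    ∀ i ∈ Finset.Icc 1 (n + 5), 0 ≤ replaceFive n x e a b c d i := by
  intro i hi
  have := h i hi
  simp only [replaceFive]
  split_ifs <;> assumption

end ReplaceFive

theorem IsOptimal.le_lagrangian_colexGraph {n m : ℕ} {E : Finset (Finset ℕ)} {x : ℕ → ℝ}
    (h : IsOptimal (n + 5) m E x) (hm : m + 3 = (n + 5).choose 3) :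
    edgeWeight E x ≤ (colexGraph 3 m).lagrangian := by
  set P := (Finset.Icc 1 (n + 5)).powersetCard 3 with hP
  have hPE : P \ (P \ E) = E := by rw [Finset.sdiff_sdiff_eq_self h.subset]
  have hmem : ∀ {p q r : ℕ}, 1 ≤ p → p < q → q < r → r ≤ n + 5 → ({p, q, r} : Finset ℕ) ∈ P :=
    triple_mem_powersetCard
  have hswap : ∀ e ∈ P \ E, ∀ i ∈ e, ∀ j ∈ Finset.Icc 1 (n + 5), i < j → j ∉ e →
      insert j (e.erase i) ∈ P → insert j (e.erase i) ∈ P \ E := by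
    intro e he i hi j hj hij hje hjP
    obtain ⟨heP, heE⟩ := Finset.mem_sdiff.1 he
    refine Finset.mem_sdiff.2 ⟨hjP, fun hE => heE ?_⟩
    have hj' : j ∉ e.erase i := fun hj => hje (Finset.mem_of_mem_erase hj)
    have := h.compressed _ hE i ((Finset.mem_powersetCard.1 heP).1 hi) j
      (Finset.mem_insert_self _ _) hij (by simp [hij.ne])
    rwa [Finset.erase_insert hj', Finset.insert_erase hi] at this
  have hup : ∀ p q r p' q' r', p < q → q < r → ({p, q, r} : Finset ℕ) ∈ P \ E → p ≤ p' →
      q ≤ q' → r ≤ r' → p' < q' → q' < r' → r' ≤ n + 5 →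
      ({p', q', r'} : Finset ℕ) ∈ P \ E := by
    intro p q r p' q' r' hpq hqr hM hp hq hr hpq' hqr' hr'
    have hp1 : 1 ≤ p := (Finset.mem_Icc.1 ((Finset.mem_powersetCard.1
      (Finset.mem_sdiff.1 hM).1).1 (by simp))).1
    have h1 : ({p, q, r'} : Finset ℕ) ∈ P \ E := by
      rcases hr.eq_or_lt with rfl | hr
      · exact hM
      have hs : insert r' (({p, q, r} : Finset ℕ).erase r) = {p, q, r'} := by
        ext k
        simp only [Finset.mem_insert, Finset.mem_erase, Finset.mem_singleton]
        omega
      rw [← hs]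
      refine hswap _ hM r (by simp) r' (Finset.mem_Icc.2 ⟨by omega, hr'⟩) hr (by simp; omega) ?_
      rw [hs]
      exact hmem hp1 hpq (by omega) hr'
    have h2 : ({p, q', r'} : Finset ℕ) ∈ P \ E := by
      rcases hq.eq_or_lt with rfl | hq
      · exact h1
      have hs : insert q' (({p, q, r'} : Finset ℕ).erase q) = {p, q', r'} := by
        ext k
        simp only [Finset.mem_insert, Finset.mem_erase, Finset.mem_singleton]
        omega
      rw [← hs]
      refine hswap _ h1 q (by simp) q' (Finset.mem_Icc.2 ⟨by omega, by omega⟩) hq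
        (by simp; omega) ?_
      rw [hs]
      exact hmem hp1 (by omega) hqr' hr'
    rcases hp.eq_or_lt with rfl | hp
    · exact h2
    have hs : insert p' (({p, q', r'} : Finset ℕ).erase p) = {p', q', r'} := by
      ext k
      simp only [Finset.mem_insert, Finset.mem_erase, Finset.mem_singleton]
      omega
    rw [← hs]
    refine hswap _ h2 p (by simp) p' (Finset.mem_Icc.2 ⟨by omega, by omega⟩) hp (by simp; omega) ?_
    rw [hs]
    exact hmem (by omega) hpq' hqr' hr'
  have hMc : (P \ E).card = 3 := by
    rw [card_powersetCard_sdiff h.subset, h.card]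
    omega
  rcases eq_colexTail_or_eq_lastStar Finset.sdiff_subset hMc hup with hM | hM
  · rw [← hPE, hM]
    exact edgeWeight_le_lagrangian_colexGraph hm h.nonneg h.sum_eq
  have hI : ∀ {i}, 1 ≤ i → i ≤ n + 5 → i ∈ Finset.Icc 1 (n + 5) := fun h1 h2 =>
    Finset.mem_Icc.2 ⟨h1, h2⟩
  have hanti : ∀ i j, 1 ≤ i → i ≤ j → j ≤ n + 5 → x j ≤ x i := fun i j h1 h2 h3 =>
    h.antitone (hI h1 (by omega)) (hI (by omega) h3) h2
  have hE : ∀ y, edgeWeight E y = edgeWeight P y - edgeWeight (lastStar n) y := by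
    intro y
    rw [← edgeWeight_sdiff (lastStar_subset n), ← hM, hPE]
  rcases (h.nonneg _ (hI (by omega) le_rfl)).eq_or_lt with hd | hd
  · refine le_trans ?_ (edgeWeight_le_lagrangian_colexGraph hm h.nonneg h.sum_eq)
    rw [hE, edgeWeight_sdiff (colexTail_subset n), edgeWeight_colexTail, edgeWeight_lastStar, ← hd]
    simp [hP]
  have hsum := h.sum_eq
  rw [sum_Icc_add_five] at hsum
  have hR : ∑ i ∈ Finset.Icc 1 n, x i = 0 ∨ x (n + 1) ≤ ∑ i ∈ Finset.Icc 1 n, x i := by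
    rcases Nat.eq_zero_or_pos n with rfl | hn
    · left
      simp
    · right
      refine (hanti n (n + 1) hn (by omega) (by omega)).trans ?_
      refine Finset.single_le_sum (f := x) (fun i hi => ?_) (Finset.mem_Icc.2 ⟨hn, le_rfl⟩)
      rw [Finset.mem_Icc] at hi
      exact h.nonneg i (hI hi.1 (by omega))
  obtain ⟨g, y, hg, hy, hgy, hle⟩ := exists_fivePoly_ge hR
    (hanti (n + 1) (n + 2) (by omega) (by omega) (by omega))
    (hanti (n + 2) (n + 3) (by omega) (by omega) (by omega))
    (hanti (n + 3) (n + 4) (by omega) (by omega) (by omega))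
    (hanti (n + 4) (n + 5) (by omega) (by omega) (by omega)) hd
    (fun e' a' b' c' d' he ha hb hc hd' hs => by
      obtain ⟨v1, v2, v3, v4, v5⟩ := replaceFive_vals (n := n) (x := x) (e := e') (a := a')
        (b := b') (c := c') (d := d')
      have h1 := h.le E (replaceFive n x e' a' b' c' d') ⟨h.subset, h.card,
        replaceFive_nonneg h.nonneg he ha hb hc hd', by
          rw [sum_Icc_add_five, sum_replaceFive, v1, v2, v3, v4, v5]
          linarith⟩
      rw [hE, hE, edgeWeight_lastStar, edgeWeight_lastStar, edgeWeight_powersetCard_three,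
        edgeWeight_powersetCard_three, edgeWeight_replaceFive, edgeWeight_replaceFive,
        sum_replaceFive, v1, v2, v3, v4, v5, hs] at h1
      linarith)
  obtain ⟨v1, v2, v3, v4, v5⟩ := replaceFive_vals (n := n) (x := x) (e := g) (a := g) (b := g)
    (c := y) (d := y)
  refine le_trans ?_ (edgeWeight_le_lagrangian_colexGraph hm
    (y := replaceFive n x g g g y y) (replaceFive_nonneg h.nonneg hg hg hg hy hy) ?_)
  · rw [hE, edgeWeight_sdiff (colexTail_subset n), edgeWeight_colexTail, edgeWeight_lastStar,
      edgeWeight_powersetCard_three, edgeWeight_powersetCard_three, edgeWeight_replaceFive,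
      edgeWeight_replaceFive, sum_replaceFive, v1, v2, v3, v4, v5,
      show g + g + g + y + y = 3 * g + 2 * y by ring, hgy]
    linarith
  · rw [sum_Icc_add_five, sum_replaceFive, v1, v2, v3, v4, v5]
    linarith

theorem IsFeasible.extend {N N' m : ℕ} {E : Finset (Finset ℕ)} {x : ℕ → ℝ}
    (h : IsFeasible N m E x) (hN : N ≤ N') :
    ∃ x', IsFeasible N' m E x' ∧ edgeWeight E x' = edgeWeight E x := by
  have hsub : Finset.Icc 1 N ⊆ Finset.Icc 1 N' := Finset.Icc_subset_Icc le_rfl hN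
  refine ⟨fun k => if k ∈ Finset.Icc 1 N then x k else 0,
    ⟨h.subset.trans (Finset.powersetCard_mono hsub), h.card, fun i _ => ?_, ?_⟩, ?_⟩
  · split_ifs with hi
    exacts [h.nonneg i hi, le_rfl]
  · rw [← h.sum_eq, Finset.sum_ite_mem, Finset.inter_eq_right.2 hsub]
  · refine Finset.sum_congr rfl fun e he => Finset.prod_congr rfl fun i hi => ?_
    exact if_pos ((Finset.mem_powersetCard.1 (h.subset he)).1 hi)

theorem IsFeasible.le_lagrangian_colexGraph {n m N : ℕ} (hm : m + 3 = (n + 5).choose 3)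
    (hN : n + 5 ≤ N) : ∀ {E : Finset (Finset ℕ)} {x : ℕ → ℝ}, IsFeasible N m E x →
      edgeWeight E x ≤ (colexGraph 3 m).lagrangian := by
  induction N, hN using Nat.le_induction with
  | base =>
    intro E x h
    obtain ⟨E', x', h'⟩ := exists_isOptimal (n := n + 5) (m := m) (by omega) (by omega)
    exact (h'.le E x h).trans (h'.le_lagrangian_colexGraph hm)
  | succ N hN ih =>
    intro E x h
    have h1 : (n + 5).choose 3 ≤ N.choose 3 := Nat.choose_le_choose 3 hN
    have h2 : N.choose 3 ≤ (N + 1).choose 3 := Nat.choose_le_choose 3 (by omega)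
    obtain ⟨E', x', h'⟩ := exists_isOptimal (n := N + 1) (m := m) (by omega) (by omega)
    obtain ⟨E'', x'', hf, hle⟩ := h'.exists_isFeasible_pred (by omega) (by omega)
    exact (h'.le E x h).trans (hle.trans (ih hf))

theorem RGraph.verts_nonempty {V : Type*} {r : ℕ} (H : RGraph V (r + 1))
    (hH : H.edges.Nonempty) : H.verts.Nonempty := by
  obtain ⟨e, he⟩ := hH
  obtain ⟨hs, hc⟩ := Finset.mem_powersetCard.1 (H.edges_subset he)
  exact (Finset.card_pos.1 (by omega)).mono hs

theorem RGraph.lagrangian_le_colexGraph {V : Type*} {n m : ℕ} (hm : m + 3 = (n + 5).choose 3)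
    (H : RGraph V 3) (hH : H.edges.card = m) :
    H.lagrangian ≤ (colexGraph 3 m).lagrangian := by
  have hm0 : 0 < m := by
    have := le_choose_three n
    omega
  have hne := H.verts_nonempty (Finset.card_pos.1 (hH ▸ hm0))
  obtain ⟨⟨x, hx, hxw⟩, -⟩ := H.isGreatest_lagrangian hne
  obtain ⟨E', x', h1, h2, h3, h4, h5, -⟩ := exists_relabel H.verts hne H.edges H.edges_subset x
  have hf : IsFeasible H.verts.card m E' x' := ⟨h1, h2.trans hH, h5 hx.1, h4.trans hx.2⟩
  obtain ⟨x'', hf', hw⟩ := hf.extend (le_max_left _ (n + 5))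
  rw [hxw]
  change edgeWeight H.edges x ≤ _
  rw [← h3, ← hw]
  exact hf'.le_lagrangian_colexGraph hm (le_max_right _ _)

theorem mul_le_of_sum_le_one {a b c : ℝ} (ha : 0 ≤ a) (hb : 0 ≤ b) (hc : 0 ≤ c)
    (h : a + b + c ≤ 1) : a * b * c ≤ 1 / 27 := by
  have h1 : 27 * (a * b * c) ≤ (a + b + c) ^ 3 := by
    nlinarith [mul_nonneg ha (sq_nonneg (b - c)), mul_nonneg hb (sq_nonneg (c - a)),
      mul_nonneg hc (sq_nonneg (a - b)), mul_nonneg ha (sq_nonneg (a - b)),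
      mul_nonneg ha (sq_nonneg (c - a)), mul_nonneg hb (sq_nonneg (a - b)),
      mul_nonneg hb (sq_nonneg (b - c)), mul_nonneg hc (sq_nonneg (c - a)),
      mul_nonneg hc (sq_nonneg (b - c))]
  have h2 : (a + b + c) ^ 3 ≤ 1 := pow_le_one₀ (by positivity) h
  linarith

theorem RGraph.lagrangian_eq_of_card_edges_eq_one {V : Type*} (H : RGraph V 3)
    (hH : H.edges.card = 1) : H.lagrangian = 1 / 27 := by
  classical
  obtain ⟨e, he⟩ := Finset.card_eq_one.1 hH
  obtain ⟨hs, hc⟩ := Finset.mem_powersetCard.1 (H.edges_subset (he ▸ Finset.mem_singleton_self e))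
  obtain ⟨⟨x, hx, hxw⟩, hub⟩ :=
    H.isGreatest_lagrangian (H.verts_nonempty (he ▸ Finset.singleton_nonempty e))
  have hw : ∀ x : V → ℝ, H.weight x = ∏ i ∈ e, x i := by
    intro x
    unfold RGraph.weight
    rw [he, Finset.sum_singleton]
  refine le_antisymm ?_ (hub ⟨fun i => if i ∈ e then 1 / 3 else 0, ⟨fun i _ => ?_, ?_⟩, ?_⟩)
  · rw [hxw, hw]
    have hsum : ∑ i ∈ e, x i ≤ 1 := by
      rw [← hx.2]
      exact Finset.sum_le_sum_of_subset_of_nonneg hs fun i hi _ => hx.1 i hi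
    have h0 : ∀ i ∈ e, 0 ≤ x i := fun i hi => hx.1 i (hs hi)
    obtain ⟨a, b, c, hab, hac, hbc, rfl⟩ := Finset.card_eq_three.1 hc
    rw [Finset.sum_insert (by simp [hab, hac]), Finset.sum_pair hbc, ← add_assoc] at hsum
    rw [Finset.prod_insert (by simp [hab, hac]), Finset.prod_pair hbc, ← mul_assoc]
    exact mul_le_of_sum_le_one (h0 a (by simp)) (h0 b (by simp)) (h0 c (by simp)) hsum
  · positivity
  · rw [Finset.sum_ite_mem, Finset.inter_eq_right.2 hs, Finset.sum_const, hc]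
    norm_num
  · rw [hw, Finset.prod_congr rfl fun i hi => if_pos hi, Finset.prod_const, hc]
    norm_num

theorem hasLargestLagrangian_of_card_edges_eq_one (G : RGraph ℕ 3) (hG : G.edges.card = 1) :
    HasLargestLagrangian.{u} G 1 :=
  ⟨hG, fun _ H hH => by
    rw [H.lagrangian_eq_of_card_edges_eq_one hH, G.lagrangian_eq_of_card_edges_eq_one hG]⟩

theorem choose_three_ne {n m : ℕ} (hm : m + 3 = (n + 5).choose 3) (s : ℕ) : m ≠ s.choose 3 := by
  have h1 : (n + 5).choose 3 = (n + 4).choose 2 + (n + 4).choose 3 := Nat.choose_succ_succ _ _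
  have h2 : Nat.choose 4 2 ≤ (n + 4).choose 2 := Nat.choose_le_choose 2 (by omega)
  have h3 : Nat.choose 4 2 = 6 := by decide
  rcases Nat.lt_or_ge s (n + 5) with h | h
  · have := Nat.choose_le_choose 3 (show s ≤ n + 4 by omega)
    omega
  · have := Nat.choose_le_choose 3 h
    omega

theorem corollary1p8 (m t : ℕ) (hm : 0 < m) (ht : 0 < t)
    (hmt : (m : ℤ) = (t.choose 3 : ℤ) - 3) :
    HasLargestLagrangian.{u} (colexGraph 3 m) m ∧
      ∀ s : ℕ, m = s.choose 3 → HasLargestLagrangian.{u} (RGraph.complete s 3) m := by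
  have hmt' : m + 3 = t.choose 3 := by omega
  have hcard : (colexGraph 3 m).edges.card = m := card_colexFirst 3 m (by omega)
  rcases Nat.lt_or_ge t 5 with h | h
  · obtain rfl : m = 1 := by
      interval_cases t <;> simp [Nat.choose] at hmt'; omega
    refine ⟨hasLargestLagrangian_of_card_edges_eq_one _ hcard, fun s hs =>
      hasLargestLagrangian_of_card_edges_eq_one _ ?_⟩
    change ((Finset.Icc 1 s).powersetCard 3).card = 1
    rw [Finset.card_powersetCard, Nat.card_Icc, Nat.add_sub_cancel, hs]
  · obtain ⟨n, rfl⟩ : ∃ n, t = n + 5 := ⟨t - 5, by omega⟩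
    exact ⟨⟨hcard, fun V H hH => H.lagrangian_le_colexGraph hmt' hH⟩,
      fun s hs => absurd hs (choose_three_ne hmt' s)⟩
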